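/- Let $\mathbb N=\{1,2,\ldots\}$. For real $q>1$, an expansion of a real number $x$ in base $q$ is a sequence $(c_i)_{i\ge1}$ of integers with $0\le c_i<q$ for all $i$ and $\sum_{i\ge1}c_iq^{-i}=x$. Let $\mathcal U_q$ be the set of real numbers having exactly one expansion in base $q$, and let $\mathcal U$ be the set of all $q>1$ such that $1\in\mathcal U_q$. The quasi-greedy expansion $(\alpha_i)$ of $1$ in base $q$ is the lexicographically largest expansion of $1$ having infinitely many nonzero digits. Let $\mathcal V$ be the set of all $q>1$ such that, in lexicographical order, $$(\alpha_1-\alpha_{k+1})(\alpha_1-\alpha_{k+2})\ldots\le\alpha_1\alpha_2\ldots\quad\text{for all }k\ge1.$$ Bars denote closures in $\mathbb R$. A Cantor set is a nonempty closed subset of $\mathbb R$ having neither interior nor isolated points. Let $L$ and $R$ be the sets of left, respectively right, endpoints of the connected components $(q_1,q_2)$ of $(1,\infty)\setminus\mathcal V$. (i) $L=\mathbb N\cup(\mathcal V\setminus\mathcal U)$ and $R=\mathcal V\setminus\overline{\mathcal U}$. Hence $R\subset L$, and $(1,\infty)\setminus\overline{\mathcal U}=\bigcup(q_1,q_2]$,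 where the union runs over the connected components $(q_1,q_2)$ of $(1,\infty)\setminus\mathcal V$. (ii) If $q\in\{2,3,\ldots\}$, then neither $\mathcal U_q$ nor $\overline{\mathcal U_q}$ is a Cantor set. (iii) If $q\in\overline{\mathcal U}\setminus\mathbb N$, then $\mathcal U_q$ is not a Cantor set, but its closure $\overline{\mathcal U_q}$ is a Cantor set. (iv) If $q\in(q_1,q_2]$, where $(q_1,q_2)$ is a connected component of $(1,\infty)\setminus\mathcal V$, then $\mathcal U_q$ is closed, and it is a Cantor set if and only if $q_1\in\{3,4,\ldots\}\cup(\overline{\mathcal U}\setminus\mathcal U)$. Moreover, if $q_1\in\{1,2\}\cup(\mathcal V\setminus\overline{\mathcal U})$, then the isolated points of $\mathcal U_q$ form a dense subset of $\mathcal U_q$. -/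

import Mathlib

open Set Filter Topology

namespace UniqueExpansions

noncomputable section

/-- `c` is an expansion of `x` in base `q`. Sequences are indexed from `0`, so that `c i` is the
digit `c_{i+1}` of weight `q^{-(i+1)}`; digits are integers in `[0, q)`. -/
def IsExpansion (q x : ℝ) (c : ℕ → ℕ) : Prop :=
  (∀ i, (c i : ℝ) < q) ∧ HasSum (fun i => (c i : ℝ) / q ^ (i + 1)) x

/-- A sequence is infinite if it has infinitely many nonzero elements. -/
def IsInfinite (c : ℕ → ℕ) : Prop := {i | c i ≠ 0}.Infinite

/-- `a` is the quasi-greedy expansion of `x ≠ 0` in base `q`: the largest infinite expansion in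
the lexicographical order. -/
def IsQuasiGreedy (q x : ℝ) (a : ℕ → ℕ) : Prop :=
  IsExpansion q x a ∧ IsInfinite a ∧
    ∀ c : ℕ → ℕ, IsExpansion q x c → IsInfinite c → toLex c ≤ toLex a

/-- The set `𝒰_q` of real numbers with exactly one expansion in base `q`. -/
def univoqueSet (q : ℝ) : Set ℝ := {x | ∃! c : ℕ → ℕ, IsExpansion q x c}

/-- The set `𝒰` of univoque numbers: the bases `q > 1` in which `1` has exactly one expansion. -/
def univoqueNumbers : Set ℝ := {q | 1 < q ∧ (1 : ℝ) ∈ univoqueSet q}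

/-- The set `𝒱` of bases `q > 1` such that the quasi-greedy expansion `α` of `1` satisfies
`conj (α_{k+1} α_{k+2} …) ≤ α_1 α_2 …` for all `k ≥ 1`, where `conj c = α_1 - c` digitwise.
All digits of `α` are at most `α_1 = ⌈q⌉ - 1`, so the subtraction does not truncate. -/
def vNumbers : Set ℝ :=
  {q | 1 < q ∧ ∃ α : ℕ → ℕ, IsQuasiGreedy q 1 α ∧
    ∀ k : ℕ, 1 ≤ k → toLex (fun i => α 0 - α (k + i)) ≤ toLex α}

/-- The open interval `(q₁, q₂)` is a connected component of `(1, ∞) \ 𝒱`. -/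
def IsGap (q₁ q₂ : ℝ) : Prop :=
  ∃ x ∈ Ioi (1 : ℝ) \ vNumbers, connectedComponentIn (Ioi (1 : ℝ) \ vNumbers) x = Ioo q₁ q₂

/-- The set `L` of left endpoints of the components of `(1, ∞) \ 𝒱`. -/
def leftEndpoints : Set ℝ := {q₁ | ∃ q₂, IsGap q₁ q₂}

/-- The set `R` of right endpoints of the components of `(1, ∞) \ 𝒱`. -/
def rightEndpoints : Set ℝ := {q₂ | ∃ q₁, IsGap q₁ q₂}

/-- The integers `≥ m`, as a set of real numbers. -/
def integersFrom (m : ℕ) : Set ℝ := {x | ∃ n : ℕ, m ≤ n ∧ x = n}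

/-- The isolated points of `C`: the points of `C` which are not accumulation points of `C`. -/
def isolatedPoints (C : Set ℝ) : Set ℝ := {x | x ∈ C ∧ ¬ AccPt x (𝓟 C)}

/-- A Cantor set: a nonempty closed set having neither interior nor isolated points. -/
def IsCantorSet (C : Set ℝ) : Prop :=
  C.Nonempty ∧ IsClosed C ∧ interior C = ∅ ∧ isolatedPoints C = ∅

end

end UniqueExpansions

open UniqueExpansions

namespace UniqueExpansions

/-! Bases are replaced by sequences. By Parry's criterion `q ↦ qg q` is an increasing bijection of
`(1, ∞)` onto the infinite sequences that dominate all their shifts (`eq_qg`, `exists_qg_eq`,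
`qg_slt_qg_iff`). A number lies in `𝒰_q` exactly when it is the value of a sequence in `admissible
(qg q 0) (qg q)` (`mem_univoqueSet_iff`). Hence `𝒰`, `𝒱` and the intermediate set `wNumbers` become
lexicographic conditions on `qg q`, and `wNumbers` turns out to be the closure of `𝒰`.

Gaps of `𝒱` are coded by finite words `u` (`GapWord`). Write `u⁻` for `u` with its last digit
lowered and `ū` for its reflection. The gap of `u` goes from the base with expansion `(u⁻)^∞` to the
base with expansion `(uū)^∞`: a sequence that dominates its shifts and exceeds `(u⁻)^∞` exceeds `u`,
and domination of the reflected shifts pushes it up to `(uū)^∞`. Elements of `𝒱 \ 𝒰` have periodic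
expansions, whose shortest period yields a gap on the right; elements of `𝒱 \ wNumbers` have the
form `(uū)^∞` and end a gap on the left. Conversely, elements of `wNumbers` are limits from the left
of `𝒱`, and non-integer elements of `𝒰` are limits from the right. Points of `𝒱 \ wNumbers` are
therefore isolated in `𝒱`, while a point of `wNumbers` is approximated by univoque bases with
expansions `w (conj w⁻)^∞`, `w` a long prefix. This gives (i).

In integer bases irrational numbers have unique expansions, whence (ii). For the rest the tool is
gluing (`exists_append_mem_admissible`): an admissible sequence may be cut at suitable places and
continued by any sequence close to a fixed `a` whose shifts and reflected shifts are small. In bases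
of `wNumbers`, `a = qg q` is a limit of such continuations, so no point is isolated, and `0 (qg q)`
is a limit with a second expansion, so `𝒰_q` is not closed.

In a gap the admissible sequences are those of the finite word `u` (`GapPair.admissible_eq`), a
compact set independent of the base. Gluing makes `𝒰_q` perfect when `(u⁻)^∞` can be approximated in
the required way. When `(u⁻)^∞ = (xx̄)^∞`, the word `x` forces all later digits
(`GapWord.shift_eq_of_tie`), and isolated points are dense; the gaps starting at `1` and `2` are
treated directly. -/

/-! ### Lexicographic order on sequences -/

/-- The strict lexicographic order on sequences. -/
def SLt (a b : ℕ → ℕ) : Prop := toLex a < toLex b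

/-- The lexicographic order on sequences. -/
def SLe (a b : ℕ → ℕ) : Prop := toLex a ≤ toLex b

infix:50 " ≺ " => SLt
infix:50 " ≼ " => SLe

/-- The sequence `a` with its first `k` elements deleted. -/
def shift (k : ℕ) (a : ℕ → ℕ) : ℕ → ℕ := fun i => a (k + i)

/-- The reflection of `a` in the alphabet `{0, …, M}`. -/
def conj (M : ℕ) (a : ℕ → ℕ) : ℕ → ℕ := fun i => M - a i

/-- `a` and `b` have the same first `l` elements. -/
def Tie (l : ℕ) (a b : ℕ → ℕ) : Prop := ∀ i < l, a i = b i

/-- `a` is smaller than `b`, and this is visible on the first `l` elements. -/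
def PLt (l : ℕ) (a b : ℕ → ℕ) : Prop := ∃ i < l, Tie i a b ∧ a i < b i

/-- The first `l` elements of `a` form a word which is at most that of `b`. -/
def PLe (l : ℕ) (a b : ℕ → ℕ) : Prop := PLt l a b ∨ Tie l a b

@[simp] lemma shift_apply (k : ℕ) (a : ℕ → ℕ) (i : ℕ) : shift k a i = a (k + i) := rfl

@[simp] lemma conj_apply (M : ℕ) (a : ℕ → ℕ) (i : ℕ) : conj M a i = M - a i := rfl

@[simp] lemma shift_zero (a : ℕ → ℕ) : shift 0 a = a := by
  funext i; simp

@[simp] lemma shift_shift (k l : ℕ) (a : ℕ → ℕ) : shift k (shift l a) = shift (l + k) a := by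
  funext i; simp [add_assoc]

lemma conj_shift (M k : ℕ) (a : ℕ → ℕ) : conj M (shift k a) = shift k (conj M a) := rfl

lemma conj_conj {M : ℕ} {a : ℕ → ℕ} (ha : ∀ i, a i ≤ M) : conj M (conj M a) = a := by
  funext i; have := ha i; simp; omega

lemma conj_conj_shift {M : ℕ} {a : ℕ → ℕ} (ha : ∀ i, a i ≤ M) (k : ℕ) :
    conj M (conj M (shift k a)) = shift k a :=
  conj_conj fun i => ha (k + i)

lemma conj_le (M : ℕ) (a : ℕ → ℕ) (i : ℕ) : conj M a i ≤ M := Nat.sub_le _ _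

lemma slt_iff {a b : ℕ → ℕ} : a ≺ b ↔ ∃ i, Tie i a b ∧ a i < b i := Iff.rfl

lemma SLt.irrefl (a : ℕ → ℕ) : ¬ a ≺ a := lt_irrefl (toLex a)

lemma SLt.trans {a b c : ℕ → ℕ} (h : a ≺ b) (h' : b ≺ c) : a ≺ c := lt_trans (a := toLex a) h h'

lemma SLt.le {a b : ℕ → ℕ} (h : a ≺ b) : a ≼ b := le_of_lt (a := toLex a) h

lemma SLe.refl (a : ℕ → ℕ) : a ≼ a := le_refl (toLex a)

lemma SLe.trans_lt {a b c : ℕ → ℕ} (h : a ≼ b) (h' : b ≺ c) : a ≺ c :=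
  lt_of_le_of_lt (a := toLex a) h h'

lemma SLt.trans_le {a b c : ℕ → ℕ} (h : a ≺ b) (h' : b ≼ c) : a ≺ c :=
  lt_of_lt_of_le (a := toLex a) h h'

lemma SLe.antisymm {a b : ℕ → ℕ} (h : a ≼ b) (h' : b ≼ a) : a = b :=
  toLex_inj.1 (le_antisymm (a := toLex a) h h')

lemma not_slt {a b : ℕ → ℕ} : ¬ a ≺ b ↔ b ≼ a := not_lt (a := toLex a)

lemma SLe.eq_or_lt {a b : ℕ → ℕ} (h : a ≼ b) : a = b ∨ a ≺ b := by
  rcases eq_or_lt_of_le (α := Lex (ℕ → ℕ)) h with h | h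
  · exact Or.inl (toLex_inj.1 h)
  · exact Or.inr h

lemma SLe.lt_of_ne {a b : ℕ → ℕ} (h : a ≼ b) (h' : a ≠ b) : a ≺ b :=
  h.eq_or_lt.resolve_left h'

lemma slt_trichotomy (a b : ℕ → ℕ) : a ≺ b ∨ a = b ∨ b ≺ a := by
  by_cases h : a ≺ b
  · exact Or.inl h
  · rcases (not_slt.1 h).eq_or_lt with h | h
    · exact Or.inr (Or.inl h.symm)
    · exact Or.inr (Or.inr h)

lemma Tie.symm {l : ℕ} {a b : ℕ → ℕ} (h : Tie l a b) : Tie l b a := fun i hi => (h i hi).symm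

lemma Tie.mono {l l' : ℕ} {a b : ℕ → ℕ} (h : Tie l a b) (hl : l' ≤ l) : Tie l' a b :=
  fun i hi => h i (hi.trans_le hl)

lemma Tie.trans {l : ℕ} {a b c : ℕ → ℕ} (h : Tie l a b) (h' : Tie l b c) : Tie l a c :=
  fun i hi => (h i hi).trans (h' i hi)

lemma Tie.eq {l : ℕ} {a b : ℕ → ℕ} (h : Tie l a b) (h' : shift l a = shift l b) : a = b := by
  funext i
  rcases lt_or_ge i l with hi | hi
  · exact h i hi
  · have := congrFun h' (i - l)
    simpa [Nat.add_sub_cancel' hi] using this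

lemma PLt.lt {l : ℕ} {a b : ℕ → ℕ} (h : PLt l a b) : a ≺ b := by
  obtain ⟨i, -, h⟩ := h
  exact slt_iff.2 ⟨i, h⟩

lemma PLt.mono {l l' : ℕ} {a b : ℕ → ℕ} (h : PLt l a b) (hl : l ≤ l') : PLt l' a b := by
  obtain ⟨i, hi, h⟩ := h
  exact ⟨i, hi.trans_le hl, h⟩

lemma PLt.congr {l : ℕ} {a b a' b' : ℕ → ℕ} (h : PLt l a b) (ha : Tie l a a') (hb : Tie l b b') :
    PLt l a' b' := by
  obtain ⟨i, hi, h, h'⟩ := h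
  refine ⟨i, hi, fun j hj => ?_, ?_⟩
  · rw [← ha j (hj.trans hi), ← hb j (hj.trans hi), h j hj]
  · rwa [← ha i hi, ← hb i hi]

lemma PLe.congr {l : ℕ} {a b a' b' : ℕ → ℕ} (h : PLe l a b) (ha : Tie l a a') (hb : Tie l b b') :
    PLe l a' b' :=
  h.imp (fun h => h.congr ha hb) fun h => (ha.symm.trans h).trans hb

lemma PLt.trans_le {l : ℕ} {a b c : ℕ → ℕ} (h : PLt l a b) (h' : PLe l b c) : PLt l a c := by
  rcases h' with h' | h'
  · obtain ⟨i, hi, h1, h2⟩ := h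
    obtain ⟨j, hj, h3, h4⟩ := h'
    rcases lt_trichotomy i j with hij | rfl | hij
    · exact ⟨i, hi, h1.trans (h3.mono hij.le), h3 i hij ▸ h2⟩
    · exact ⟨i, hi, h1.trans h3, h2.trans h4⟩
    · exact ⟨j, hj, (h1.mono hij.le).trans h3, h1 j hij ▸ h4⟩
  · exact h.congr (fun _ _ => rfl) h'

lemma SLt.cases (l : ℕ) {a b : ℕ → ℕ} (h : a ≺ b) :
    PLt l a b ∨ (Tie l a b ∧ shift l a ≺ shift l b) := by
  obtain ⟨i, h1, h2⟩ := slt_iff.1 h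
  rcases lt_or_ge i l with hi | hi
  · exact Or.inl ⟨i, hi, h1, h2⟩
  · refine Or.inr ⟨h1.mono hi, slt_iff.2 ⟨i - l, fun j hj => h1 _ (by omega), ?_⟩⟩
    simpa [Nat.add_sub_cancel' hi] using h2

lemma Tie.lt {l : ℕ} {a b : ℕ → ℕ} (h : Tie l a b) (h' : shift l a ≺ shift l b) : a ≺ b := by
  obtain ⟨i, h1, h2⟩ := slt_iff.1 h'
  refine slt_iff.2 ⟨l + i, fun j hj => ?_, h2⟩
  rcases lt_or_ge j l with hjl | hjl
  · exact h j hjl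
  · have := h1 (j - l) (by omega)
    simpa [Nat.add_sub_cancel' hjl] using this

lemma Tie.le {l : ℕ} {a b : ℕ → ℕ} (h : Tie l a b) (h' : shift l a ≼ shift l b) : a ≼ b := by
  rcases h'.eq_or_lt with h' | h'
  · rw [h.eq h']; exact SLe.refl _
  · exact (h.lt h').le

lemma SLe.cases (l : ℕ) {a b : ℕ → ℕ} (h : a ≼ b) :
    PLt l a b ∨ (Tie l a b ∧ shift l a ≼ shift l b) := by
  rcases h.eq_or_lt with rfl | h
  · exact Or.inr ⟨fun _ _ => rfl, SLe.refl _⟩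
  · exact (h.cases l).imp id fun h => ⟨h.1, h.2.le⟩

lemma SLe.ple (l : ℕ) {a b : ℕ → ℕ} (h : a ≼ b) : PLe l a b := (h.cases l).imp id And.left

lemma Tie.shift_lt {l : ℕ} {a b : ℕ → ℕ} (h : Tie l a b) (h' : a ≺ b) :
    shift l a ≺ shift l b := by
  rcases h'.cases l with h' | h'
  · obtain ⟨i, hi, -, h'⟩ := h'
    exact absurd (h i hi) h'.ne
  · exact h'.2

lemma Tie.shift_le {l : ℕ} {a b : ℕ → ℕ} (h : Tie l a b) (h' : a ≼ b) :
    shift l a ≼ shift l b := by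
  rcases h'.eq_or_lt with rfl | h'
  · exact SLe.refl _
  · exact (h.shift_lt h').le

lemma PLt.not_tie {l : ℕ} {a b : ℕ → ℕ} (h : PLt l a b) : ¬ Tie l a b := by
  obtain ⟨i, hi, -, h⟩ := h
  exact fun h' => h.ne (h' i hi)

lemma slt_of_apply_zero {a b : ℕ → ℕ} (h : a 0 < b 0) : a ≺ b :=
  slt_iff.2 ⟨0, fun _ hj => absurd hj (Nat.not_lt_zero _), h⟩

lemma SLe.apply_zero {a b : ℕ → ℕ} (h : a ≼ b) : a 0 ≤ b 0 := by
  by_contra! h'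
  exact SLt.irrefl _ (h.trans_lt (slt_of_apply_zero h'))

lemma Tie.conj {l M : ℕ} {a b : ℕ → ℕ} (h : Tie l a b) : Tie l (conj M a) (conj M b) :=
  fun i hi => by simp [h i hi]

lemma PLt.conj {l M : ℕ} {a b : ℕ → ℕ} (hb : ∀ i, b i ≤ M) (h : PLt l a b) :
    PLt l (conj M b) (conj M a) := by
  obtain ⟨i, hi, h, h'⟩ := h
  refine ⟨i, hi, h.symm.conj, ?_⟩
  have := hb i
  simp only [conj_apply]; omega

lemma SLt.conj {M : ℕ} {a b : ℕ → ℕ} (hb : ∀ i, b i ≤ M) (h : a ≺ b) :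
    conj M b ≺ conj M a := by
  obtain ⟨i, h⟩ := slt_iff.1 h
  exact (PLt.conj (l := i + 1) hb ⟨i, i.lt_succ_self, h⟩).lt

lemma SLe.conj {M : ℕ} {a b : ℕ → ℕ} (hb : ∀ i, b i ≤ M) (h : a ≼ b) :
    conj M b ≼ conj M a := by
  rcases h.eq_or_lt with rfl | h
  · exact SLe.refl _
  · exact (h.conj hb).le

lemma le_apply_zero_of_shift_le {a : ℕ → ℕ} (h : ∀ k, shift k a ≼ a) (i : ℕ) : a i ≤ a 0 := by
  simpa using (h i).apply_zero

/-- If the shifts of `c` at the positions in `P` are smaller than `B`, then there are arbitrarily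
late places at which all these inequalities are visible. -/
lemma exists_forall_plt {c B : ℕ → ℕ} {P : ℕ → Prop} (hB : ∀ k, shift k B ≼ B)
    (hc : ∀ k, P k → shift k c ≺ B) (J : ℕ) :
    ∃ j ≥ J, ∀ k < j, P k → PLt (j - k) (shift k c) B := by
  classical
  by_cases H : ∃ k, k < J ∧ P k ∧ ¬ PLt (J - k) (shift k c) B
  swap
  · push Not at H
    exact ⟨J, le_rfl, H⟩
  obtain ⟨hkJ, hPk, hk⟩ := Nat.find_spec H
  have hmin := fun k' (h : k' < Nat.find H) => Nat.find_min H h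
  set k := Nat.find H
  obtain ⟨i, h1, h2⟩ := slt_iff.1 (hc k hPk)
  have hi : J - k ≤ i := by
    by_contra! hlt
    exact hk ⟨i, hlt, h1, h2⟩
  -- `k` is the first position undecided before `J`, and `i` is where it is decided. Positions
  -- before `k` are decided already; those after `k` inherit the decision at `k + i`, being compared
  -- there with a shift of `B`, which is at most `B`.
  refine ⟨k + i + 1, by omega, fun k2 hk2 hP => ?_⟩
  rcases lt_trichotomy k2 k with h | rfl | h
  · have := hmin k2 h
    push Not at this
    exact (this (by omega) hP).mono (by omega)
  · exact ⟨i, by omega, h1, h2⟩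
  · obtain ⟨d, rfl⟩ := Nat.exists_eq_add_of_lt h
    have e : k + i + 1 - (k + d + 1) = i - d := by omega
    rw [e]
    have : PLt (i - d) (shift (k + d + 1) c) (shift (d + 1) B) := by
      refine ⟨i - (d + 1), by omega, fun j hj => ?_, ?_⟩
      · have := h1 (d + 1 + j) (by omega)
        simp only [shift_apply] at this ⊢
        rw [← this]; congr 1; ring
      · have e1 : d + 1 + (i - (d + 1)) = i := by omega
        have e2 : k + d + 1 + (i - (d + 1)) = k + i := by omega
        simpa only [shift_apply, e1, e2] using h2
    exact this.trans_le ((hB (d + 1)).ple _)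

/-! ### Values of sequences in a base -/

/-- The value of the sequence `c` in base `q`. -/
noncomputable def val (q : ℝ) (c : ℕ → ℕ) : ℝ := ∑' i, (c i : ℝ) / q ^ (i + 1)

lemma hasSum_geometric_digits {q : ℝ} (hq : 1 < q) (M : ℝ) :
    HasSum (fun i : ℕ => M / q ^ (i + 1)) (M / (q - 1)) := by
  have h0 : 0 < q := by linarith
  have h := (hasSum_geometric_of_lt_one (inv_nonneg.2 h0.le) (inv_lt_one_of_one_lt₀ hq)).mul_left
    (M / q)
  have e : M / q * (1 - q⁻¹)⁻¹ = M / (q - 1) := by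
    have : q - 1 ≠ 0 := by linarith
    field_simp
  rw [e] at h
  refine h.congr_fun fun i => ?_
  rw [pow_succ, inv_pow]; field_simp

lemma summable_val {q : ℝ} (hq : 1 < q) {M : ℕ} {c : ℕ → ℕ} (hc : ∀ i, c i ≤ M) :
    Summable fun i => (c i : ℝ) / q ^ (i + 1) := by
  have h0 : 0 < q := by linarith
  refine Summable.of_nonneg_of_le (fun i => by positivity) (fun i => ?_)
    (hasSum_geometric_digits hq (M : ℝ)).summable
  have : (c i : ℝ) ≤ M := by exact_mod_cast hc i
  gcongr

lemma hasSum_val {q : ℝ} (hq : 1 < q) {M : ℕ} {c : ℕ → ℕ} (hc : ∀ i, c i ≤ M) :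
    HasSum (fun i => (c i : ℝ) / q ^ (i + 1)) (val q c) :=
  (summable_val hq hc).hasSum

lemma val_nonneg {q : ℝ} (hq : 1 < q) (c : ℕ → ℕ) : 0 ≤ val q c :=
  tsum_nonneg fun i => by have : 0 < q := by linarith
                          positivity

lemma val_le {q : ℝ} (hq : 1 < q) {M : ℕ} {c : ℕ → ℕ} (hc : ∀ i, c i ≤ M) :
    val q c ≤ M / (q - 1) := by
  have h0 : 0 < q := by linarith
  refine hasSum_le (fun i => ?_) (hasSum_val hq hc) (hasSum_geometric_digits hq (M : ℝ))
  have : (c i : ℝ) ≤ M := by exact_mod_cast hc i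
  gcongr

lemma val_const {q : ℝ} (hq : 1 < q) (M : ℕ) : val q (fun _ => M) = M / (q - 1) :=
  (hasSum_geometric_digits hq (M : ℝ)).tsum_eq

lemma val_conj {q : ℝ} (hq : 1 < q) {M : ℕ} {c : ℕ → ℕ} (hc : ∀ i, c i ≤ M) :
    val q (conj M c) = M / (q - 1) - val q c := by
  refine (((hasSum_geometric_digits hq (M : ℝ)).sub (hasSum_val hq hc)).congr_fun
    fun i => ?_).tsum_eq
  rw [conj_apply, Nat.cast_sub (hc i)]; ring

lemma val_pos {q : ℝ} (hq : 1 < q) {M : ℕ} {c : ℕ → ℕ} (hc : ∀ i, c i ≤ M) {i : ℕ}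
    (hi : c i ≠ 0) : 0 < val q c := by
  have h0 : 0 < q := by linarith
  have : 0 < (c i : ℝ) := by exact_mod_cast Nat.pos_of_ne_zero hi
  exact (summable_val hq hc).tsum_pos (fun i => by positivity) i (by positivity)

lemma val_split {q : ℝ} (hq : 1 < q) {M : ℕ} {c : ℕ → ℕ} (hc : ∀ i, c i ≤ M) (n : ℕ) :
    val q c = ∑ i ∈ Finset.range n, (c i : ℝ) / q ^ (i + 1) + val q (shift n c) / q ^ n := by
  have h0 : 0 < q := by linarith
  rw [val, ← (summable_val hq hc).sum_add_tsum_nat_add n, val, ← tsum_div_const]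
  congr 1
  refine tsum_congr fun i => ?_
  rw [shift_apply, div_div, ← pow_add, add_comm n i]
  congr 2; ring

lemma val_succ {q : ℝ} (hq : 1 < q) {M : ℕ} {c : ℕ → ℕ} (hc : ∀ i, c i ≤ M) :
    val q c = (c 0 + val q (shift 1 c)) / q := by
  rw [val_split hq hc 1]; simp [add_div]

lemma val_sub_of_tie {q : ℝ} (hq : 1 < q) {M : ℕ} {a b : ℕ → ℕ} (ha : ∀ i, a i ≤ M)
    (hb : ∀ i, b i ≤ M) {n : ℕ} (h : Tie n a b) :
    val q a - val q b = (val q (shift n a) - val q (shift n b)) / q ^ n := by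
  rw [val_split hq ha n, val_split hq hb n, Finset.sum_congr rfl fun i hi => by
    rw [h i (Finset.mem_range.1 hi)]]
  ring

lemma val_sub_of_tie_succ {q : ℝ} (hq : 1 < q) {M : ℕ} {a b : ℕ → ℕ} (ha : ∀ i, a i ≤ M)
    (hb : ∀ i, b i ≤ M) {n : ℕ} (h : Tie n a b) :
    val q a - val q b = (((a n : ℝ) - b n) + (val q (shift (n + 1) a) -
      val q (shift (n + 1) b))) / q ^ (n + 1) := by
  have h0 : 0 < q := by linarith
  rw [val_sub_of_tie hq ha hb h, val_succ hq (c := shift n a) (fun i => ha (n + i)),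
    val_succ hq (c := shift n b) (fun i => hb (n + i))]
  simp only [shift_shift, shift_apply, add_zero]
  field_simp
  ring

/-- The partial sums telescope to `x 0 - x n / q ^ n`, and bounded remainders make the error vanish.
This serves both the greedy and the quasi-greedy algorithm. -/
lemma hasSum_of_rem {q : ℝ} (hq : 1 < q) {c : ℕ → ℕ} {x : ℕ → ℝ} {C : ℝ}
    (hx : ∀ n, x (n + 1) = q * x n - c n) (h0 : ∀ n, 0 ≤ x n) (hC : ∀ n, x n ≤ C) :
    HasSum (fun i => (c i : ℝ) / q ^ (i + 1)) (x 0) := by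
  have hq0 : 0 < q := by linarith
  have hsum : ∀ n, ∑ i ∈ Finset.range n, (c i : ℝ) / q ^ (i + 1) = x 0 - x n / q ^ n := by
    intro n
    induction n with
    | zero => simp
    | succ n ih =>
      rw [Finset.sum_range_succ, ih, hx, pow_succ]; field_simp; ring
  rw [hasSum_iff_tendsto_nat_of_nonneg (fun i => by positivity)]
  simp only [hsum]
  have h1 : Tendsto (fun n : ℕ => C / q ^ n) atTop (𝓝 0) :=
    tendsto_const_nhds.div_atTop (tendsto_pow_atTop_atTop_of_one_lt hq)
  have h2 : Tendsto (fun n : ℕ => x n / q ^ n) atTop (𝓝 0) :=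
    squeeze_zero (fun n => div_nonneg (h0 n) (by positivity))
      (fun n => by have := hC n; gcongr) h1
  simpa using tendsto_const_nhds.sub h2

/-- If `a` is larger than `b` and the tails of `b` have value at most `1`, then `a` has a larger
value. -/
lemma val_le_of_slt {q : ℝ} (hq : 1 < q) {M : ℕ} {a b : ℕ → ℕ} (ha : ∀ i, a i ≤ M)
    (hb : ∀ i, b i ≤ M) (h1 : ∀ n, val q (shift (n + 1) b) ≤ 1) (h : b ≺ a) :
    ∃ n, val q b + val q (shift (n + 1) a) / q ^ (n + 1) ≤ val q a := by
  have hq0 : 0 < q := by linarith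
  obtain ⟨n, ht, hn⟩ := slt_iff.1 h
  refine ⟨n, ?_⟩
  have e := val_sub_of_tie_succ hq ha hb ht.symm
  have hn' : (b n : ℝ) + 1 ≤ a n := by exact_mod_cast hn
  have : val q (shift (n + 1) a) / q ^ (n + 1) ≤ val q a - val q b := by
    rw [e]
    have := h1 n
    gcongr
    linarith
  linarith

/-- If the shifts of `c` at the positions in `P` are at most `b`, and `b` has value at most `1`,
then so do these shifts. -/
lemma val_shift_le_one {q : ℝ} (hq : 1 < q) {M : ℕ} {b c : ℕ → ℕ} (hb : ∀ i, b i ≤ M)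
    (hc : ∀ i, c i ≤ M) {P : ℕ → Prop} (hP : ∀ k, P k → shift k c ≼ b)
    (hstep : ∀ k i, c (k + i) < b i → P (k + i + 1)) (h1 : val q b ≤ 1) {k : ℕ} (hk : P k) :
    val q (shift k c) ≤ 1 := by
  have hq0 : 0 < q := by linarith
  have hC : (0 : ℝ) ≤ M / (q - 1) := div_nonneg (Nat.cast_nonneg _) (by linarith)
  -- At the first disagreement with `b` any excess over `1` is passed on to a later position of `P`,
  -- divided by at least `q`. Iterating from the trivial bound `M / (q - 1)` leaves no excess.
  have key : ∀ n : ℕ, ∀ k, P k → val q (shift k c) - 1 ≤ (M / (q - 1)) / q ^ n := by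
    intro n
    induction n with
    | zero =>
      intro k _
      have := val_le hq (M := M) (c := shift k c) (fun i => hc _)
      simp only [pow_zero, div_one]; linarith
    | succ n ih =>
      intro k hk
      rcases (hP k hk).eq_or_lt with h | h
      · rw [h]
        exact (sub_nonpos.2 h1).trans (by positivity)
      · obtain ⟨i, ht, hi⟩ := slt_iff.1 h
        have e := val_sub_of_tie_succ hq (a := shift k c) (fun i => hc _) hb ht
        have hi' : (shift k c i : ℝ) + 1 ≤ b i := by exact_mod_cast hi
        have h2 := ih (k + i + 1) (hstep k i hi)
        have h3 := val_nonneg hq (shift (i + 1) b)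
        rw [shift_shift, ← add_assoc] at e
        calc val q (shift k c) - 1 ≤ val q (shift k c) - val q b := by linarith
          _ ≤ ((M / (q - 1)) / q ^ n) / q ^ (i + 1) := by
            rw [e]; gcongr; linarith
          _ ≤ ((M / (q - 1)) / q ^ n) / q ^ 1 := by
            have : q ^ 1 ≤ q ^ (i + 1) := pow_le_pow_right₀ hq.le (by omega)
            gcongr
          _ = _ := by rw [pow_one, div_div, pow_succ]
  have h2 : Tendsto (fun n : ℕ => (M / (q - 1)) / q ^ n) atTop (𝓝 0) :=
    tendsto_const_nhds.div_atTop (tendsto_pow_atTop_atTop_of_one_lt hq)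
  have := ge_of_tendsto' h2 fun n => key n k hk
  linarith

lemma val_strictAnti {p q : ℝ} (hp : 1 < p) (hpq : p < q) {M : ℕ} {a : ℕ → ℕ}
    (ha : ∀ i, a i ≤ M) {i : ℕ} (hi : a i ≠ 0) : val q a < val p a := by
  have h0 : 0 < p := by linarith
  have h0' : 0 < q := by linarith
  have hi' : 0 < (a i : ℝ) := by exact_mod_cast Nat.pos_of_ne_zero hi
  refine (hasSum_val (hp.trans hpq) ha).summable.tsum_lt_tsum (i := i) (fun j => ?_) ?_
    (hasSum_val hp ha).summable
  · show _ / _ ≤ _ / _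
    gcongr
  · show _ / _ < _ / _
    gcongr

lemma continuousOn_val (r : ℝ) (hr : 1 < r) (M : ℕ) :
    ContinuousOn (fun p : ℝ × (ℕ → ℕ) => val p.1 p.2) {p | r ≤ p.1 ∧ ∀ i, p.2 i ≤ M} := by
  have h0 : 0 < r := by linarith
  refine continuousOn_tsum (u := fun i => (M : ℝ) / r ^ (i + 1)) (fun i => ?_)
    (hasSum_geometric_digits hr (M : ℝ)).summable ?_
  · refine ContinuousOn.div ?_ (by fun_prop) ?_
    · have h : Continuous fun n : ℕ => (n : ℝ) := continuous_of_discreteTopology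
      exact (h.comp ((continuous_apply i).comp continuous_snd)).continuousOn
    · rintro ⟨p, a⟩ ⟨hp, -⟩
      have : 0 < p := h0.trans_le hp
      positivity
  · rintro i ⟨p, a⟩ ⟨hp, ha⟩
    have hp' : 0 < p := h0.trans_le hp
    have : (a i : ℝ) ≤ M := by exact_mod_cast ha i
    rw [Real.norm_of_nonneg (by positivity)]
    simp only at hp ⊢
    gcongr

lemma continuousOn_val_left (r : ℝ) (hr : 1 < r) {M : ℕ} {a : ℕ → ℕ} (ha : ∀ i, a i ≤ M) :
    ContinuousOn (fun q => val q a) (Ici r) :=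
  (continuousOn_val r hr M).comp (f := fun q : ℝ => (q, a)) (by fun_prop) fun _ hq => ⟨hq, ha⟩

lemma continuousOn_val_right {q : ℝ} (hq : 1 < q) (M : ℕ) :
    ContinuousOn (val q) {c | ∀ i, c i ≤ M} :=
  (continuousOn_val q hq M).comp (f := fun c : ℕ → ℕ => (q, c)) (by fun_prop)
    fun _ hc => ⟨le_rfl, hc⟩

/-! ### Greedy expansions -/

/-- Remainders of the greedy algorithm with digits at most `M`. -/
noncomputable def greedyRem (M : ℕ) (q x : ℝ) : ℕ → ℝ
  | 0 => x
  | n + 1 => q * greedyRem M q x n - (min M ⌊q * greedyRem M q x n⌋₊ : ℕ)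

/-- The greedy step preserves `[0, M / (q - 1)]`: the right end is fixed by `x ↦ q * x - M`, and an
uncapped digit leaves a remainder below `1`, which is at most `M / (q - 1)` because `q ≤ M + 1`. -/
lemma exists_expansion {q : ℝ} (hq : 1 < q) {M : ℕ} (hqM : q ≤ M + 1) {x : ℝ} (hx : 0 ≤ x)
    (hx' : x ≤ M / (q - 1)) : ∃ c : ℕ → ℕ, (∀ i, c i ≤ M) ∧ val q c = x := by
  have hq1 : 0 < q - 1 := by linarith
  have hb : ∀ n, 0 ≤ greedyRem M q x n ∧ greedyRem M q x n ≤ M / (q - 1) := by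
    intro n
    induction n with
    | zero => exact ⟨hx, hx'⟩
    | succ n ih =>
      have h0 : 0 ≤ q * greedyRem M q x n := mul_nonneg (by linarith) ih.1
      simp only [greedyRem]
      rcases le_total M ⌊q * greedyRem M q x n⌋₊ with h | h
      · rw [min_eq_left h]
        have h1 : (M : ℝ) ≤ q * greedyRem M q x n := (Nat.cast_le.2 h).trans (Nat.floor_le h0)
        refine ⟨by linarith, ?_⟩
        have h2 : q * greedyRem M q x n ≤ q * (M / (q - 1)) := by
          have := ih.2
          gcongr
        have e : q * ((M : ℝ) / (q - 1)) - M = M / (q - 1) := by field_simp; ring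
        linarith
      · rw [min_eq_right h]
        have h1 := Nat.floor_le h0
        have h2 := Nat.lt_floor_add_one (q * greedyRem M q x n)
        have h3 : 1 ≤ (M : ℝ) / (q - 1) := by rw [le_div_iff₀ hq1]; linarith
        exact ⟨by linarith, by linarith⟩
  exact ⟨fun n => min M ⌊q * greedyRem M q x n⌋₊, fun i => min_le_left _ _,
    (hasSum_of_rem hq (x := greedyRem M q x) (fun n => rfl) (fun n => (hb n).1)
      fun n => (hb n).2).tsum_eq⟩

/-! ### The quasi-greedy expansion of `1` -/

/-- Remainders of the quasi-greedy algorithm. -/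
noncomputable def qgRem (q : ℝ) : ℕ → ℝ
  | 0 => 1
  | n + 1 => q * qgRem q n - (⌈q * qgRem q n⌉₊ - 1 : ℕ)

/-- The quasi-greedy expansion of `1` in base `q`. -/
noncomputable def qg (q : ℝ) (n : ℕ) : ℕ := ⌈q * qgRem q n⌉₊ - 1

/-- Taking `⌈x⌉₊ - 1` instead of the floor leaves a remainder in `(0, 1]`; that it never vanishes is
what makes the expansion infinite. -/
lemma ceil_sub_one {x : ℝ} (hx : 0 < x) :
    ((⌈x⌉₊ - 1 : ℕ) : ℝ) < x ∧ x ≤ ((⌈x⌉₊ - 1 : ℕ) : ℝ) + 1 := by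
  have h1 : 0 < ⌈x⌉₊ := Nat.ceil_pos.2 hx
  have h2 := Nat.ceil_lt_add_one hx.le
  have h3 := Nat.le_ceil x
  rw [Nat.cast_sub h1]
  push_cast
  exact ⟨by linarith, by linarith⟩

lemma qgRem_mem {q : ℝ} (hq : 1 < q) (n : ℕ) : 0 < qgRem q n ∧ qgRem q n ≤ 1 := by
  induction n with
  | zero => simp [qgRem]
  | succ n ih =>
    have := ceil_sub_one (mul_pos (by linarith : 0 < q) ih.1)
    simp only [qgRem]
    exact ⟨by linarith, by linarith⟩

lemma qg_lt {q : ℝ} (hq : 1 < q) (n : ℕ) : (qg q n : ℝ) < q := by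
  have h := qgRem_mem hq n
  have := (ceil_sub_one (mul_pos (by linarith : 0 < q) h.1)).1
  have : q * qgRem q n ≤ q * 1 := by
    have := h.2
    gcongr
  simp only [qg]; linarith

lemma qg_zero_lt {q : ℝ} (hq : 1 < q) : (qg q 0 : ℝ) < q := qg_lt hq 0

lemma le_qg_zero {q : ℝ} (hq : 1 < q) : q ≤ qg q 0 + 1 := by
  have := (ceil_sub_one (show 0 < q by linarith)).2
  simpa [qg, qgRem] using this

lemma le_qg_zero_iff {q : ℝ} (hq : 1 < q) (n : ℕ) : n ≤ qg q 0 ↔ (n : ℝ) < q := by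
  constructor
  · intro h
    exact (Nat.cast_le.2 h).trans_lt (qg_zero_lt hq)
  · intro h
    have : (n : ℝ) < (qg q 0 + 1 : ℕ) := by push_cast; exact h.trans_le (le_qg_zero hq)
    exact Nat.lt_succ_iff.1 (Nat.cast_lt.1 this)

lemma qg_zero_pos {q : ℝ} (hq : 1 < q) : 1 ≤ qg q 0 := (le_qg_zero_iff hq 1).2 (by simpa using hq)

lemma qg_le {q : ℝ} (hq : 1 < q) (n : ℕ) : qg q n ≤ qg q 0 := (le_qg_zero_iff hq _).2 (qg_lt hq n)

lemma val_shift_qg {q : ℝ} (hq : 1 < q) (n : ℕ) : val q (shift n (qg q)) = qgRem q n := by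
  have := hasSum_of_rem hq (c := shift n (qg q)) (x := fun i => qgRem q (n + i)) (C := 1)
    (fun i => rfl) (fun i => (qgRem_mem hq _).1.le) fun i => (qgRem_mem hq _).2
  exact this.tsum_eq

lemma val_qg {q : ℝ} (hq : 1 < q) : val q (qg q) = 1 := by
  simpa [qgRem] using val_shift_qg hq 0

lemma val_shift_qg_pos {q : ℝ} (hq : 1 < q) (n : ℕ) : 0 < val q (shift n (qg q)) := by
  rw [val_shift_qg hq]; exact (qgRem_mem hq n).1

lemma val_shift_qg_le {q : ℝ} (hq : 1 < q) (n : ℕ) : val q (shift n (qg q)) ≤ 1 := by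
  rw [val_shift_qg hq]; exact (qgRem_mem hq n).2

lemma isInfinite_iff {c : ℕ → ℕ} : IsInfinite c ↔ ∀ n, ∃ i, c (n + i) ≠ 0 := by
  rw [IsInfinite, Set.infinite_iff_exists_gt]
  constructor
  · intro h n
    obtain ⟨i, hi, hni⟩ := h n
    exact ⟨i - n, by rwa [Nat.add_sub_cancel' hni.le]⟩
  · intro h n
    obtain ⟨i, hi⟩ := h (n + 1)
    exact ⟨n + 1 + i, hi, by omega⟩

lemma IsInfinite.val_shift_pos {c : ℕ → ℕ} (h : IsInfinite c) {q : ℝ} (hq : 1 < q) {M : ℕ}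
    (hc : ∀ i, c i ≤ M) (n : ℕ) : 0 < val q (shift n c) := by
  obtain ⟨i, hi⟩ := isInfinite_iff.1 h n
  exact val_pos hq (M := M) (c := shift n c) (fun i => hc _) (i := i) hi

lemma isInfinite_qg {q : ℝ} (hq : 1 < q) : IsInfinite (qg q) := by
  refine isInfinite_iff.2 fun n => ?_
  by_contra! h
  have h0 : shift n (qg q) = fun _ => 0 := funext h
  have := val_shift_qg_pos hq n
  rw [h0, val_const hq] at this
  simp at this

/-- The quasi-greedy expansion is larger than any other sequence of the same value with
infinitely many nonzero digits. -/
lemma sle_qg {q : ℝ} (hq : 1 < q) {M : ℕ} {c : ℕ → ℕ} (hc : ∀ i, c i ≤ M) (hi : IsInfinite c)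
    (h1 : val q c ≤ 1) : c ≼ qg q := by
  rw [← not_slt]
  intro h
  -- A sequence above `qg q` has a value exceeding `1` by at least a scaled tail of its own, which
  -- is positive since it is infinite.
  obtain ⟨n, hn⟩ := val_le_of_slt hq (M := max M (qg q 0)) (a := c) (b := qg q)
    (fun i => (hc i).trans (le_max_left _ _)) (fun i => (qg_le hq i).trans (le_max_right _ _))
    (fun n => val_shift_qg_le hq _) h
  have := hi.val_shift_pos hq hc (n + 1)
  have h2 : 0 < val q (shift (n + 1) c) / q ^ (n + 1) := by positivity
  rw [val_qg hq] at hn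
  linarith

lemma isInfinite_shift {c : ℕ → ℕ} (h : IsInfinite c) (k : ℕ) : IsInfinite (shift k c) := by
  rw [isInfinite_iff] at h ⊢
  intro n
  obtain ⟨i, hi⟩ := h (k + n)
  exact ⟨i, by simpa [add_assoc] using hi⟩

lemma shift_qg_le {q : ℝ} (hq : 1 < q) (k : ℕ) : shift k (qg q) ≼ qg q :=
  sle_qg hq (fun _ => qg_le hq _) (isInfinite_shift (isInfinite_qg hq) k) (val_shift_qg_le hq k)

/-- Domination of the shifts bounds all tails of `a` by `1`, so the argument of `sle_qg` also runs
with the roles of `a` and `qg q` exchanged. -/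
lemma eq_qg {q : ℝ} (hq : 1 < q) {a : ℕ → ℕ} (hi : IsInfinite a) (hs : ∀ k, shift k a ≼ a)
    (h1 : val q a = 1) : a = qg q := by
  have hb := le_apply_zero_of_shift_le hs
  refine (sle_qg hq hb hi h1.le).eq_or_lt.resolve_right fun h => ?_
  have hs1 : ∀ k, val q (shift k a) ≤ 1 := fun k =>
    val_shift_le_one hq hb hb (P := fun _ => True) (fun k _ => hs k) (fun _ _ _ => trivial) h1.le
      trivial
  obtain ⟨n, hn⟩ := val_le_of_slt hq (M := max (a 0) (qg q 0)) (a := qg q) (b := a)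
    (fun i => (qg_le hq i).trans (le_max_right _ _)) (fun i => (hb i).trans (le_max_left _ _))
    (fun n => hs1 _) h
  have := val_shift_qg_pos hq (n + 1)
  have h2 : 0 < val q (shift (n + 1) (qg q)) / q ^ (n + 1) := by positivity
  rw [val_qg hq, h1] at hn
  linarith

lemma isExpansion_iff {q : ℝ} (hq : 1 < q) {x : ℝ} {c : ℕ → ℕ} :
    IsExpansion q x c ↔ (∀ i, c i ≤ qg q 0) ∧ val q c = x := by
  constructor
  · rintro ⟨h1, h2⟩
    exact ⟨fun i => (le_qg_zero_iff hq _).2 (h1 i), h2.tsum_eq⟩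
  · rintro ⟨h1, rfl⟩
    exact ⟨fun i => (le_qg_zero_iff hq _).1 (h1 i), hasSum_val hq h1⟩

lemma isQuasiGreedy_iff {q : ℝ} (hq : 1 < q) {a : ℕ → ℕ} : IsQuasiGreedy q 1 a ↔ a = qg q := by
  have h : IsQuasiGreedy q 1 (qg q) :=
    ⟨(isExpansion_iff hq).2 ⟨qg_le hq, val_qg hq⟩, isInfinite_qg hq, fun c hc hi =>
      sle_qg hq ((isExpansion_iff hq).1 hc).1 hi ((isExpansion_iff hq).1 hc).2.le⟩
  constructor
  · intro h'
    exact SLe.antisymm (h.2.2 a h'.1 h'.2.1) (h'.2.2 _ h.1 h.2.1)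
  · rintro rfl
    exact h

lemma qg_slt_qg {p q : ℝ} (hp : 1 < p) (hpq : p < q) : qg p ≺ qg q := by
  have hq := hp.trans hpq
  have h : val q (qg p) < 1 := by
    rw [← val_qg hp]
    exact val_strictAnti hp hpq (qg_le hp) (i := 0) (by have := qg_zero_pos hp; omega)
  refine (sle_qg hq (qg_le hp) (isInfinite_qg hp) h.le).lt_of_ne fun e => ?_
  rw [e, val_qg hq] at h
  exact lt_irrefl _ h

lemma qg_slt_qg_iff {p q : ℝ} (hp : 1 < p) (hq : 1 < q) : qg p ≺ qg q ↔ p < q := by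
  refine ⟨fun h => ?_, qg_slt_qg hp⟩
  by_contra! h'
  rcases h'.eq_or_lt with rfl | h'
  · exact SLt.irrefl _ h
  · exact SLt.irrefl _ (h.trans (qg_slt_qg hq h'))

lemma qg_sle_qg_iff {p q : ℝ} (hp : 1 < p) (hq : 1 < q) : qg p ≼ qg q ↔ p ≤ q := by
  rw [← not_slt, qg_slt_qg_iff hq hp, not_lt]

lemma qg_injective {p q : ℝ} (hp : 1 < p) (hq : 1 < q) (h : qg p = qg q) : p = q :=
  le_antisymm ((qg_sle_qg_iff hp hq).1 (h ▸ SLe.refl _)) ((qg_sle_qg_iff hq hp).1 (h ▸ SLe.refl _))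

/-- The value of `a` depends continuously on the base. It is at least `1` near base `1`, because `a`
has two nonzero digits, and at most `1` in base `a 0 + 1`; the intermediate value theorem and
`eq_qg` conclude. -/
lemma exists_qg_eq {a : ℕ → ℕ} (hi : IsInfinite a) (hs : ∀ k, shift k a ≼ a) :
    ∃ q, 1 < q ∧ qg q = a := by
  have hb := le_apply_zero_of_shift_le hs
  set M := a 0
  have hM : 1 ≤ M := by
    obtain ⟨i, hi⟩ := isInfinite_iff.1 hi 0
    have := hb (0 + i)
    omega
  have hM' : (1 : ℝ) ≤ M := by exact_mod_cast hM
  obtain ⟨i, hi'⟩ := isInfinite_iff.1 hi 1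
  set N := 1 + i + 1
  have h2 : (2 : ℝ) ≤ ∑ j ∈ Finset.range N, (a j : ℝ) := by
    have : 2 ≤ ∑ j ∈ Finset.range N, a j := by
      rw [Finset.sum_range_succ, add_comm 1 i, Finset.sum_range_succ', add_comm i 1]
      have : 1 ≤ a (1 + i) := Nat.one_le_iff_ne_zero.2 hi'
      have : 1 ≤ a 0 := hM
      omega
    exact_mod_cast this
  obtain ⟨r, hr1, hr2, hrN⟩ : ∃ r : ℝ, 1 < r ∧ r < 2 ∧ r ^ N < 2 := by
    have hc : Tendsto (fun r : ℝ => r ^ N) (𝓝[>] 1) (𝓝 (1 ^ N)) :=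
      ((continuous_pow N).tendsto 1).mono_left nhdsWithin_le_nhds
    rw [one_pow] at hc
    have h1 := hc.eventually (gt_mem_nhds (show (1 : ℝ) < 2 by norm_num))
    have h2 : ∀ᶠ r : ℝ in 𝓝[>] 1, r < 2 :=
      nhdsWithin_le_nhds (gt_mem_nhds (show (1 : ℝ) < 2 by norm_num))
    obtain ⟨r, ⟨h1, h2⟩, h3⟩ := ((h1.and h2).and self_mem_nhdsWithin).exists
    exact ⟨r, h3, h2, h1⟩
  have hr0 : 0 < r := by linarith
  have hge : 1 ≤ val r a := by
    rw [val_split hr1 hb N]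
    have h3 : ∑ j ∈ Finset.range N, (a j : ℝ) / r ^ N ≤
        ∑ j ∈ Finset.range N, (a j : ℝ) / r ^ (j + 1) := by
      refine Finset.sum_le_sum fun j hj => ?_
      have : r ^ (j + 1) ≤ r ^ N := pow_le_pow_right₀ hr1.le (by
        have := Finset.mem_range.1 hj; omega)
      gcongr
    rw [← Finset.sum_div] at h3
    have h4 : 1 ≤ (∑ j ∈ Finset.range N, (a j : ℝ)) / r ^ N := by
      rw [le_div_iff₀ (by positivity)]; linarith
    have h5 : 0 ≤ val r (shift N a) / r ^ N := div_nonneg (val_nonneg hr1 _) (by positivity)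
    linarith
  have hM1 : (1 : ℝ) < M + 1 := by linarith
  have hle : val (M + 1) a ≤ 1 := by
    refine (val_le hM1 hb).trans ?_
    rw [add_sub_cancel_right, div_self (by linarith)]
  obtain ⟨q, hq, h⟩ := intermediate_value_Icc' (show r ≤ M + 1 by linarith)
    ((continuousOn_val_left r hr1 hb).mono Icc_subset_Ici_self) ⟨hle, hge⟩
  have hq1 : 1 < q := hr1.trans_le hq.1
  exact ⟨q, hq1, (eq_qg hq1 hi hs h).symm⟩

/-- If sequences `qg p` and `qg q` share a long prefix, then `p` and `q` are close. -/
lemma exists_tie_dist_lt {q : ℝ} (hq : 1 < q) {ε : ℝ} (hε : 0 < ε) :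
    ∃ n, ∀ p, 1 < p → ∀ l ≥ n, Tie l (qg p) (qg q) → |p - q| < ε := by
  set r := max (q - ε) ((1 + q) / 2)
  have hr1 : 1 < r := lt_max_of_lt_right (by linarith)
  have hrq : r < q := max_lt (by linarith) (by linarith)
  have hs : 1 < q + ε := by linarith
  obtain ⟨i, h1, h2⟩ := slt_iff.1 (qg_slt_qg hr1 hrq)
  obtain ⟨j, h3, h4⟩ := slt_iff.1 (qg_slt_qg hq (show q < q + ε by linarith))
  refine ⟨i + j + 1, fun p hp l hl ht => abs_lt.2 ⟨?_, ?_⟩⟩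
  · have : qg r ≺ qg p :=
      (PLt.congr (l := l) ⟨i, by omega, h1, h2⟩ (fun _ _ => rfl) ht.symm).lt
    have := (qg_slt_qg_iff hr1 hp).1 this
    have : q - ε ≤ r := le_max_left _ _
    linarith
  · have : qg p ≺ qg (q + ε) :=
      (PLt.congr (l := l) ⟨j, by omega, h3, h4⟩ ht.symm (fun _ _ => rfl)).lt
    have := (qg_slt_qg_iff hp hs).1 this
    linarith

/-! ### Periodic sequences -/

lemma shift_mul_of_periodic {m : ℕ} {a : ℕ → ℕ} (h : shift m a = a) (n : ℕ) :
    shift (m * n) a = a := by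
  induction n with
  | zero => simp
  | succ n ih => rw [Nat.mul_succ, ← shift_shift, ih, h]

lemma shift_mod_of_periodic {m : ℕ} {a : ℕ → ℕ} (h : shift m a = a) (k : ℕ) :
    shift k a = shift (k % m) a := by
  conv_lhs => rw [← Nat.div_add_mod k m, ← shift_shift, shift_mul_of_periodic h]

lemma apply_mod_of_periodic {m : ℕ} {a : ℕ → ℕ} (h : shift m a = a) (i : ℕ) :
    a i = a (i % m) := by
  simpa using congrFun (shift_mod_of_periodic h i) 0

lemma Tie.eq_of_periodic {m : ℕ} (hm : 0 < m) {a b : ℕ → ℕ} (ha : shift m a = a)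
    (hb : shift m b = b) (h : Tie m a b) : a = b := by
  funext i
  rw [apply_mod_of_periodic ha, apply_mod_of_periodic hb, h _ (Nat.mod_lt _ hm)]

lemma isInfinite_of_periodic {m : ℕ} (hm : 0 < m) {a : ℕ → ℕ} (ha : shift m a = a) {i : ℕ}
    (hi : a i ≠ 0) : IsInfinite a := by
  refine isInfinite_iff.2 fun n => ⟨m * n - n + i, ?_⟩
  have h1 : n ≤ m * n := Nat.le_mul_of_pos_left n hm
  have h2 := congrFun (shift_mul_of_periodic ha n) i
  rw [← add_assoc, Nat.add_sub_cancel' h1]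
  rw [shift_apply] at h2
  rwa [h2]

/-! ### Words defining gaps -/

/-- `u` consists of a word of length `m` in the alphabet `{0, …, M}`, followed by zeros. The word
starts with `M`, does not end in `0`, its proper suffixes are at most, and their reflections are
smaller than, the prefixes of the same length. -/
structure GapWord (M m : ℕ) (u : ℕ → ℕ) : Prop where
  length_pos : 0 < m
  one_le : 1 ≤ M
  zero : u 0 = M
  le : ∀ i, u i ≤ M
  last : 0 < u (m - 1)
  tail : ∀ i, m ≤ i → u i = 0
  suffix_le : ∀ k, 0 < k → k < m → PLe (m - k) (shift k u) u
  conj_suffix_lt : ∀ k, 0 < k → k < m → PLt (m - k) (conj M (shift k u)) u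

/-- The periodic repetition of the word obtained from a word of length `m` by decreasing its last
digit. -/
def lowSeq (m : ℕ) (u : ℕ → ℕ) : ℕ → ℕ :=
  fun i => if i % m = m - 1 then u (m - 1) - 1 else u (i % m)

/-- The periodic repetition of a word of length `m` followed by its reflection. -/
def highSeq (M m : ℕ) (u : ℕ → ℕ) : ℕ → ℕ :=
  fun i => if i / m % 2 = 0 then u (i % m) else M - u (i % m)

namespace GapWord

variable {M m : ℕ} {u : ℕ → ℕ}

lemma shift_lowSeq (m : ℕ) (u : ℕ → ℕ) : shift m (lowSeq m u) = lowSeq m u := by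
  funext i; simp [lowSeq]

lemma lowSeq_apply_of_lt {i : ℕ} (hi : i < m - 1) : lowSeq m u i = u i := by
  have h : i % m = i := Nat.mod_eq_of_lt (by omega)
  rw [lowSeq, if_neg (by omega), h]

lemma lowSeq_last (hm : 0 < m) : lowSeq m u (m - 1) = u (m - 1) - 1 := by
  rw [lowSeq, if_pos (Nat.mod_eq_of_lt (by omega))]

lemma tie_lowSeq : Tie (m - 1) (lowSeq m u) u := fun _ hi => lowSeq_apply_of_lt hi

lemma lowSeq_le (h : GapWord M m u) (i : ℕ) : lowSeq m u i ≤ M := by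
  have := h.le (m - 1)
  have := h.le (i % m)
  unfold lowSeq
  split_ifs <;> omega

lemma plt_lowSeq (h : GapWord M m u) : PLt m (lowSeq m u) u := by
  have := h.length_pos
  refine ⟨m - 1, by omega, tie_lowSeq, ?_⟩
  rw [lowSeq_last h.length_pos]
  have := h.last
  omega

lemma shift_lowSeq_plt (h : GapWord M m u) {k : ℕ} (hk : 0 < k) (hkm : k < m) :
    PLt (m - k) (shift k (lowSeq m u)) (lowSeq m u) := by
  have h1 : PLt (m - k) (shift k (lowSeq m u)) (shift k u) := by
    refine ⟨m - 1 - k, by omega, fun i hi => lowSeq_apply_of_lt (by omega), ?_⟩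
    have e : k + (m - 1 - k) = m - 1 := by omega
    rw [shift_apply, shift_apply, e, lowSeq_last h.length_pos]
    have := h.last
    omega
  exact (h1.trans_le (h.suffix_le k hk hkm)).congr (fun _ _ => rfl)
    (tie_lowSeq.mono (by omega)).symm

lemma shift_lowSeq_le (h : GapWord M m u) (k : ℕ) : shift k (lowSeq m u) ≼ lowSeq m u := by
  rw [shift_mod_of_periodic (shift_lowSeq m u)]
  rcases Nat.eq_zero_or_pos (k % m) with hk | hk
  · rw [hk, shift_zero]; exact SLe.refl _
  · exact (h.shift_lowSeq_plt hk (Nat.mod_lt _ h.length_pos)).lt.le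

lemma lowSeq_zero (h : GapWord M m u) (hm : 2 ≤ m) : lowSeq m u 0 = M := by
  rw [lowSeq_apply_of_lt (by omega), h.zero]

/-- Lowering the last digit of the word raises the last digit of a reflected suffix by one, which
turns a strict inequality into equality at worst. -/
lemma conj_shift_lowSeq_ple (h : GapWord M m u) {k : ℕ} (hk : 0 < k) (hkm : k < m) :
    PLe (m - k) (conj M (shift k (lowSeq m u))) (lowSeq m u) := by
  obtain ⟨i, hi, ht, hlt⟩ := h.conj_suffix_lt k hk hkm
  have key : PLe (m - k) (conj M (shift k (lowSeq m u))) u := by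
    have ht' : Tie i (conj M (shift k (lowSeq m u))) u := fun j hj => by
      rw [← ht j hj]
      simp only [conj_apply, shift_apply]
      rw [lowSeq_apply_of_lt (by omega)]
    simp only [conj_apply, shift_apply] at hlt
    rcases lt_or_ge (k + i) (m - 1) with hki | hki
    · refine Or.inl ⟨i, hi, ht', ?_⟩
      simp only [conj_apply, shift_apply]
      rwa [lowSeq_apply_of_lt hki]
    · have e : k + i = m - 1 := by omega
      have hval : conj M (shift k (lowSeq m u)) i = M - (u (m - 1) - 1) := by
        simp only [conj_apply, shift_apply, e, lowSeq_last h.length_pos]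
      rw [e] at hlt
      have h1 := h.le (m - 1)
      have h2 := h.last
      rcases (show M - (u (m - 1) - 1) < u i ∨ M - (u (m - 1) - 1) = u i by omega) with h3 | h3
      · exact Or.inl ⟨i, hi, ht', hval ▸ h3⟩
      · refine Or.inr fun j hj => ?_
        rcases Nat.lt_or_ge j i with hji | hji
        · exact ht' j hji
        · obtain rfl : j = i := by omega
          rw [hval, h3]
  exact key.congr (fun _ _ => rfl) (tie_lowSeq.mono (by omega)).symm

lemma conj_shift_lowSeq_le (h : GapWord M m u) (hm : 2 ≤ m) (k : ℕ) :
    conj M (shift k (lowSeq m u)) ≼ lowSeq m u := by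
  have hle := h.lowSeq_le
  rw [shift_mod_of_periodic (shift_lowSeq m u)]
  have hkm := Nat.mod_lt k h.length_pos
  set j := k % m
  rcases Nat.eq_zero_or_pos j with hk | hk
  · rw [hk, shift_zero]
    refine (slt_of_apply_zero ?_).le
    rw [conj_apply, h.lowSeq_zero hm]
    have := h.one_le
    omega
  · rcases h.conj_shift_lowSeq_ple hk hkm with h1 | h1
    · exact h1.lt.le
    -- After a tie on `m - j` digits, the rest of the period is governed by the reflected inequality
    -- at the complementary position `m - j`. If that is a tie too, the reflected shift is `lowSeq m
    -- u` itself.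
    have e1 : m - (m - j) = j := by omega
    have h2 := h.conj_shift_lowSeq_ple (k := m - j) (by omega) (by omega)
    rw [e1] at h2
    rcases h2 with h2 | h2
    · refine h1.le ?_
      have h3 := (h2.conj hle).lt.le
      rw [conj_conj_shift hle] at h3
      rwa [← conj_shift, shift_shift, Nat.add_sub_cancel' hkm.le, shift_lowSeq]
    · have : conj M (shift j (lowSeq m u)) = lowSeq m u := by
        refine Tie.eq_of_periodic h.length_pos ?_ (shift_lowSeq m u) fun i hi => ?_
        · rw [← conj_shift, shift_shift, add_comm, ← shift_shift, shift_lowSeq]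
        · rcases lt_or_ge i (m - j) with hi' | hi'
          · exact h1 i hi'
          · have h3 := h2 (i - (m - j)) (by omega)
            simp only [conj_apply, shift_apply] at h3 ⊢
            have e2 : m - j + (i - (m - j)) = i := by omega
            have e3 : j + i = m + (i - (m - j)) := by omega
            have h4 := congrFun (shift_lowSeq m u) (i - (m - j))
            rw [shift_apply] at h4
            rw [e2] at h3
            rw [e3, h4, ← h3]
            have := hle i
            omega
      rw [this]
      exact SLe.refl _

lemma isInfinite_lowSeq (h : GapWord M m u) (hm : 2 ≤ m ∨ 2 ≤ M) : IsInfinite (lowSeq m u) := by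
  refine isInfinite_of_periodic h.length_pos (shift_lowSeq m u) (i := 0) ?_
  have := h.one_le
  have := h.length_pos
  rcases lt_or_ge m 2 with hm' | hm'
  · obtain rfl : m = 1 := by omega
    have := h.zero
    have h2 := lowSeq_last (u := u) (m := 1) (by omega)
    simp only [Nat.sub_self] at h2
    omega
  · rw [h.lowSeq_zero hm']; omega

lemma lowSeq_one (h : GapWord M 1 u) : lowSeq 1 u = fun _ => M - 1 := by
  funext i
  have := h.zero
  simp [lowSeq, Nat.mod_one, this]

lemma tie_highSeq : Tie m (highSeq M m u) u := fun i hi => by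
  simp [highSeq, Nat.div_eq_of_lt hi, Nat.mod_eq_of_lt hi]

lemma highSeq_le (h : GapWord M m u) (i : ℕ) : highSeq M m u i ≤ M := by
  have := h.le (i % m)
  unfold highSeq
  split_ifs <;> omega

lemma shift_highSeq (h : GapWord M m u) : shift m (highSeq M m u) = conj M (highSeq M m u) := by
  funext i
  have h1 : (m + i) / m = i / m + 1 := by
    rw [Nat.add_div_left _ h.length_pos]
  have h2 := h.le (i % m)
  simp only [shift_apply, conj_apply, highSeq, h1, Nat.add_mod_left]
  split_ifs <;> omega

lemma shift_highSeq_two (h : GapWord M m u) :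
    shift (m + m) (highSeq M m u) = highSeq M m u := by
  rw [← shift_shift, h.shift_highSeq, ← conj_shift, h.shift_highSeq, conj_conj h.highSeq_le]

lemma highSeq_zero (h : GapWord M m u) : highSeq M m u 0 = M := by
  rw [tie_highSeq 0 h.length_pos, h.zero]

lemma conj_highSeq_lt (h : GapWord M m u) : conj M (highSeq M m u) ≺ highSeq M m u := by
  refine slt_of_apply_zero ?_
  rw [conj_apply, h.highSeq_zero]
  have := h.one_le
  omega

lemma conj_shift_highSeq_lt (h : GapWord M m u) {k : ℕ} (hk : 0 < k) (hkm : k < m) :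
    conj M (shift k (highSeq M m u)) ≺ highSeq M m u := by
  refine ((h.conj_suffix_lt k hk hkm).congr ?_ (tie_highSeq.symm.mono (by omega))).lt
  exact Tie.conj fun i hi => (tie_highSeq (k + i) (by omega)).symm

/-- When a suffix ties with a prefix, it is followed by `ū`, and the strict reflected inequality at
`m - k` breaks the tie. -/
lemma shift_highSeq_lt (h : GapWord M m u) {k : ℕ} (hk : 0 < k) (hkm : k < m) :
    shift k (highSeq M m u) ≺ highSeq M m u := by
  have h1 : PLe (m - k) (shift k (highSeq M m u)) (highSeq M m u) :=
    (h.suffix_le k hk hkm).congr (fun i hi => (tie_highSeq (k + i) (by omega)).symm)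
      (tie_highSeq.symm.mono (by omega))
  rcases h1 with h1 | h1
  · exact h1.lt
  · refine h1.lt ?_
    rw [shift_shift, Nat.add_sub_cancel' hkm.le, h.shift_highSeq]
    have h2 := (h.conj_shift_highSeq_lt (k := m - k) (by omega) (by omega)).conj h.highSeq_le
    rwa [conj_conj_shift h.highSeq_le] at h2

lemma shift_highSeq_mod (h : GapWord M m u) (k : ℕ) :
    shift k (highSeq M m u) = shift (k % m) (highSeq M m u) ∨
      shift k (highSeq M m u) = conj M (shift (k % m) (highSeq M m u)) := by
  have key : ∀ n, shift (m * n) (highSeq M m u) = highSeq M m u ∨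
      shift (m * n) (highSeq M m u) = conj M (highSeq M m u) := by
    intro n
    induction n with
    | zero => left; simp
    | succ n ih =>
      rw [Nat.mul_succ, ← shift_shift]
      rcases ih with ih | ih
      · right; rw [ih, h.shift_highSeq]
      · left; rw [ih, ← conj_shift, h.shift_highSeq, conj_conj h.highSeq_le]
  have e : shift k (highSeq M m u) = shift (k % m) (shift (m * (k / m)) (highSeq M m u)) := by
    rw [shift_shift, Nat.div_add_mod]
  rcases key (k / m) with h1 | h1
  · left; rw [e, h1]
  · right; rw [e, h1, conj_shift]

lemma shift_mod_highSeq_le (h : GapWord M m u) (k : ℕ) :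
    shift (k % m) (highSeq M m u) ≼ highSeq M m u ∧
      conj M (shift (k % m) (highSeq M m u)) ≼ highSeq M m u := by
  rcases Nat.eq_zero_or_pos (k % m) with hk | hk
  · rw [hk, shift_zero]
    exact ⟨SLe.refl _, h.conj_highSeq_lt.le⟩
  · have hkm := Nat.mod_lt k h.length_pos
    exact ⟨(h.shift_highSeq_lt hk hkm).le, (h.conj_shift_highSeq_lt hk hkm).le⟩

lemma shift_highSeq_le (h : GapWord M m u) (k : ℕ) :
    shift k (highSeq M m u) ≼ highSeq M m u := by
  rcases h.shift_highSeq_mod k with e | e <;> rw [e]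
  · exact (h.shift_mod_highSeq_le k).1
  · exact (h.shift_mod_highSeq_le k).2

lemma conj_shift_highSeq_le (h : GapWord M m u) (k : ℕ) :
    conj M (shift k (highSeq M m u)) ≼ highSeq M m u := by
  rcases h.shift_highSeq_mod k with e | e <;> rw [e]
  · exact (h.shift_mod_highSeq_le k).2
  · rw [conj_conj_shift h.highSeq_le]
    exact (h.shift_mod_highSeq_le k).1

lemma isInfinite_highSeq (h : GapWord M m u) : IsInfinite (highSeq M m u) := by
  have := h.length_pos
  have := h.one_le
  exact isInfinite_of_periodic (by omega) h.shift_highSeq_two (i := 0)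
    (by rw [h.highSeq_zero]; omega)

lemma lowSeq_lt_highSeq (h : GapWord M m u) : lowSeq m u ≺ highSeq M m u :=
  (h.plt_lowSeq.congr (fun _ _ => rfl) tie_highSeq.symm).lt

lemma not_slt_tail (h : GapWord M m u) {l : ℕ} (hl : m ≤ l) (a : ℕ → ℕ) : ¬ a ≺ shift l u := by
  rintro h'
  obtain ⟨i, -, hi⟩ := slt_iff.1 h'
  rw [shift_apply, h.tail _ (by omega)] at hi
  exact Nat.not_lt_zero _ hi

lemma plt_of_slt (h : GapWord M m u) {a : ℕ → ℕ} (ha : a ≺ u) : PLt m a u :=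
  (ha.cases m).resolve_right fun h' => h.not_slt_tail le_rfl _ h'.2

lemma not_isInfinite (h : GapWord M m u) : ¬ IsInfinite u := by
  intro h'
  obtain ⟨i, hi⟩ := isInfinite_iff.1 h' m
  exact hi (h.tail _ (by omega))

/-- A sequence dominating its shifts and larger than `lowSeq m u` is larger than `u`. -/
lemma slt_of_lowSeq_slt (h : GapWord M m u) {a : ℕ → ℕ} (ha : IsInfinite a)
    (hs : ∀ k, shift k a ≼ a) (hlt : lowSeq m u ≺ a) : u ≺ a := by
  by_contra hn
  have h1 : a ≺ u := (not_slt.1 hn).lt_of_ne fun e => h.not_isInfinite (e ▸ ha)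
  have h2 : ∀ k, PLt m (shift k a) u := fun k => h.plt_of_slt ((hs k).trans_lt h1)
  -- Every block of length `m` in `a` is below the word. Exceeding `lowSeq m u` at `n < m` would
  -- give a block at least as large as the word; for `n ≥ m` one period is deleted.
  have key : ∀ n k, Tie n (lowSeq m u) (shift k a) → ¬ lowSeq m u n < shift k a n := by
    intro n
    induction n using Nat.strong_induction_on with
    | _ n ih =>
      intro k ht hn
      have h3 := h2 k
      rcases lt_or_ge n m with hnm | hnm
      · have h4 : PLe m u (shift k a) := by
          rcases lt_or_ge n (m - 1) with hn' | hn'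
          · refine Or.inl ⟨n, hnm, fun i hi => ?_, ?_⟩
            · rw [← ht i hi, lowSeq_apply_of_lt (by omega)]
            · rwa [lowSeq_apply_of_lt hn'] at hn
          · obtain rfl : n = m - 1 := by omega
            rw [lowSeq_last h.length_pos] at hn
            have h5 : Tie (m - 1) u (shift k a) := tie_lowSeq.symm.trans ht
            rcases (show u (m - 1) < shift k a (m - 1) ∨ u (m - 1) = shift k a (m - 1) by omega)
              with h6 | h6
            · exact Or.inl ⟨m - 1, hnm, h5, h6⟩
            · refine Or.inr fun i hi => ?_
              rcases lt_or_ge i (m - 1) with hi' | hi'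
              · exact h5 i hi'
              · obtain rfl : i = m - 1 := by omega
                exact h6
        exact SLt.irrefl _ (h3.trans_le h4).lt
      · have := h.length_pos
        refine ih (n - m) (by omega) (k + m) (fun i hi => ?_) ?_
        · rw [← shift_lowSeq, ← shift_shift, shift_apply, shift_apply]
          exact ht (m + i) (by omega)
        · rw [← shift_lowSeq, ← shift_shift, shift_apply, shift_apply, Nat.add_sub_cancel' hnm]
          exact hn
  obtain ⟨n, hn1, hn2⟩ := slt_iff.1 hlt
  exact key n 0 (by rwa [shift_zero]) (by rwa [shift_zero])

/-- No sequence of the type occurring for elements of `𝒱` lies strictly between `u` and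
`highSeq M m u`. -/
lemma highSeq_le_of_slt (h : GapWord M m u) {a : ℕ → ℕ}
    (hs : ∀ k, 1 ≤ k → conj (a 0) (shift k a) ≼ a) (hlt : u ≺ a) : highSeq M m u ≼ a := by
  rw [← not_slt]
  intro hlt'
  have h0 : a 0 = M := by
    have h1 := hlt.le.apply_zero
    have h2 := hlt'.le.apply_zero
    rw [h.zero] at h1
    rw [h.highSeq_zero] at h2
    omega
  -- Lying between `u` and `highSeq M m u`, `a` starts with the word. Deleting the word and
  -- reflecting yields a reflected shift above `highSeq M m u`, hence above `a`.
  have ht : Tie m u a := by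
    refine (hlt.le.ple m).resolve_left fun h1 => ?_
    exact (h1.trans_le (hlt'.le.ple m)).not_tie tie_highSeq.symm
  have h1 := (tie_highSeq.trans ht).symm.shift_lt hlt'
  rw [h.shift_highSeq] at h1
  have h2 := h1.conj (M := M) (conj_le _ _)
  rw [conj_conj h.highSeq_le] at h2
  have h3 := hs m h.length_pos
  rw [h0] at h3
  exact SLt.irrefl _ ((hlt'.trans h2).trans_le h3)

end GapWord

/-! ### Gaps -/

lemma mem_vNumbers_iff {q : ℝ} (hq : 1 < q) :
    q ∈ vNumbers ↔ ∀ k, 1 ≤ k → conj (qg q 0) (shift k (qg q)) ≼ qg q := by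
  constructor
  · rintro ⟨-, α, hα, h⟩
    rw [isQuasiGreedy_iff hq] at hα
    subst hα
    exact h
  · intro h
    exact ⟨hq, qg q, (isQuasiGreedy_iff hq).2 rfl, h⟩

/-- A maximal interval avoiding `𝒱` has its endpoints in `𝒱`, except that the leftmost one starts at
`1`, which `𝒱` excludes by definition. -/
lemma isGap_iff {q₁ q₂ : ℝ} : IsGap q₁ q₂ ↔ q₁ < q₂ ∧ (∀ q ∈ Ioo q₁ q₂, q ∉ vNumbers) ∧
    (q₁ = 1 ∨ q₁ ∈ vNumbers) ∧ q₂ ∈ vNumbers := by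
  constructor
  · rintro ⟨x, hx, h⟩
    have hxm : x ∈ Ioo q₁ q₂ := h ▸ mem_connectedComponentIn hx
    have hsub : Ioo q₁ q₂ ⊆ Ioi 1 \ vNumbers := h ▸ connectedComponentIn_subset _ _
    have h1 : 1 ≤ q₁ := by
      by_contra! hlt
      have hy : (q₁ + min x 1) / 2 ∈ Ioo q₁ q₂ := by
        have := lt_min hxm.1 hlt
        have h2 := min_le_left x 1
        exact ⟨by linarith, by linarith [hxm.2]⟩
      have := (hsub hy).1
      have h2 := min_le_right x 1
      simp only [mem_Ioi] at this
      linarith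
    have h2 : 1 < q₂ := h1.trans_lt (hxm.1.trans hxm.2)
    have hmax : ∀ s : Set ℝ, IsPreconnected s → x ∈ s → s ⊆ Ioi 1 \ vNumbers → s ⊆ Ioo q₁ q₂ :=
      fun s hs hxs h' => h ▸ hs.subset_connectedComponentIn hxs h'
    refine ⟨hxm.1.trans hxm.2, fun q hq => (hsub hq).2, ?_, ?_⟩
    · by_contra! hn
      have := hmax (Ico q₁ q₂) isPreconnected_Ico ⟨hxm.1.le, hxm.2⟩ fun y hy => by
        rcases hy.1.eq_or_lt with rfl | hy'
        · exact ⟨lt_of_le_of_ne h1 hn.1.symm, hn.2⟩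
        · exact hsub ⟨hy', hy.2⟩
      exact lt_irrefl _ (this ⟨le_rfl, hxm.1.trans hxm.2⟩).1
    · by_contra! hn
      have := hmax (Ioc q₁ q₂) isPreconnected_Ioc ⟨hxm.1, hxm.2.le⟩ fun y hy => by
        rcases hy.2.eq_or_lt with rfl | hy'
        · exact ⟨h2, hn⟩
        · exact hsub ⟨hy.1, hy'⟩
      exact lt_irrefl _ (this ⟨hxm.1.trans hxm.2, le_rfl⟩).2
  · rintro ⟨hlt, hV, h1, h2⟩
    have h1' : 1 ≤ q₁ := h1.elim (fun h => h.ge) fun h => h.1.le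
    have hsub : Ioo q₁ q₂ ⊆ Ioi 1 \ vNumbers := fun y hy => ⟨h1'.trans_lt hy.1, hV y hy⟩
    obtain ⟨x, hx⟩ := exists_between hlt
    refine ⟨x, hsub hx, subset_antisymm (fun y hy => ?_)
      (isPreconnected_Ioo.subset_connectedComponentIn hx hsub)⟩
    have hc := (isPreconnected_connectedComponentIn (F := Ioi 1 \ vNumbers) (x := x)).ordConnected
    have hxc := mem_connectedComponentIn (hsub hx)
    have hsubc := connectedComponentIn_subset (Ioi 1 \ vNumbers) x
    constructor
    · by_contra! hn
      have := hsubc (hc.out hy hxc ⟨hn, hx.1.le⟩)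
      rcases h1 with h1 | h1
      · exact (this.1 : 1 < q₁).ne' h1
      · exact this.2 h1
    · by_contra! hn
      exact (hsubc (hc.out hxc hy ⟨hx.2.le, hn⟩)).2 h2

lemma IsGap.right_unique {q₁ q₂ q₂' : ℝ} (h : IsGap q₁ q₂) (h' : IsGap q₁ q₂') : q₂ = q₂' := by
  rw [isGap_iff] at h h'
  rcases lt_trichotomy q₂ q₂' with hlt | rfl | hlt
  · exact absurd h.2.2.2 (h'.2.1 _ ⟨h.1, hlt⟩)
  · rfl
  · exact absurd h'.2.2.2 (h.2.1 _ ⟨h'.1, hlt⟩)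

/-- The word `u` defines the pair `(q₁, q₂)`. -/
structure GapPair (M m : ℕ) (u : ℕ → ℕ) (q₁ q₂ : ℝ) : Prop where
  word : GapWord M m u
  -- The degenerate case is the word `1` over `{0, 1}`: its `lowSeq` is zero and expands `1` in no
  -- base.
  left : (q₁ = 1 ∧ M = 1 ∧ m = 1) ∨ (1 < q₁ ∧ qg q₁ = lowSeq m u)
  one_lt : 1 < q₂
  right : qg q₂ = highSeq M m u

lemma qg_natCast {M : ℕ} (hM : 1 ≤ M) : qg (M + 1 : ℕ) = fun _ => M := by
  have hq : (1 : ℝ) < (M + 1 : ℕ) := by exact_mod_cast Nat.lt_succ_of_le hM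
  have hM0 : (M : ℝ) ≠ 0 := by
    have : M ≠ 0 := by omega
    exact_mod_cast this
  refine (eq_qg hq (isInfinite_of_periodic (m := 1) one_pos rfl (i := 0) (by omega))
    (fun k => SLe.refl _) ?_).symm
  rw [val_const hq]
  push_cast
  rw [add_sub_cancel_right, div_self hM0]

lemma integersFrom_subset_vNumbers : integersFrom 2 ⊆ vNumbers := by
  rintro _ ⟨n, hn, rfl⟩
  obtain ⟨M, rfl⟩ := Nat.exists_eq_add_of_le' (show 1 ≤ n by omega)
  have hM : 1 ≤ M := by omega
  rw [mem_vNumbers_iff (by exact_mod_cast hn)]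
  intro k _
  rw [qg_natCast hM]
  refine (slt_of_apply_zero ?_).le
  simp
  omega

namespace GapPair

variable {M m : ℕ} {u : ℕ → ℕ} {q₁ q₂ : ℝ}

lemma one_le (h : GapPair M m u q₁ q₂) : 1 ≤ q₁ :=
  h.left.elim (fun h => h.1.ge) fun h => h.1.le

lemma lt (h : GapPair M m u q₁ q₂) : q₁ < q₂ := by
  rcases h.left with h' | h'
  · rw [h'.1]; exact h.one_lt
  · rw [← qg_slt_qg_iff h'.1 h.one_lt, h'.2, h.right]
    exact h.word.lowSeq_lt_highSeq

lemma slt_qg (h : GapPair M m u q₁ q₂) {q : ℝ} (hq : q₁ < q) : u ≺ qg q := by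
  have hq1 := h.one_le.trans_lt hq
  refine h.word.slt_of_lowSeq_slt (isInfinite_qg hq1) (shift_qg_le hq1) ?_
  rcases h.left with ⟨-, rfl, rfl⟩ | h'
  · rw [h.word.lowSeq_one]
    refine slt_of_apply_zero ?_
    have := qg_zero_pos hq1
    omega
  · rw [← h'.2]
    exact qg_slt_qg h'.1 hq

lemma qg_sle (h : GapPair M m u q₁ q₂) {q : ℝ} (hq : q ∈ Ioc q₁ q₂) : qg q ≼ highSeq M m u := by
  rw [← h.right, qg_sle_qg_iff (h.one_le.trans_lt hq.1) h.one_lt]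
  exact hq.2

lemma isGap (h : GapPair M m u q₁ q₂) : IsGap q₁ q₂ := by
  refine isGap_iff.2 ⟨h.lt, fun q hq hV => ?_, ?_, ?_⟩
  · have hq1 := h.one_le.trans_lt hq.1
    have h1 := h.word.highSeq_le_of_slt ((mem_vNumbers_iff hq1).1 hV) (h.slt_qg hq.1)
    rw [← h.right, qg_sle_qg_iff h.one_lt hq1] at h1
    exact absurd h1 (not_le.2 hq.2)
  · rcases h.left with h' | h'
    · exact Or.inl h'.1
    · refine Or.inr ((mem_vNumbers_iff h'.1).2 fun k _ => ?_)
      rw [h'.2]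
      rcases lt_or_ge m 2 with hm | hm
      · obtain rfl : m = 1 := by have := h.word.length_pos; omega
        rw [h.word.lowSeq_one]
        have := qg_zero_pos h'.1
        rw [h'.2, h.word.lowSeq_one] at this
        refine (slt_of_apply_zero ?_).le
        simp only [conj_apply, shift_apply] at this ⊢
        omega
      · rw [h.word.lowSeq_zero hm]
        exact h.word.conj_shift_lowSeq_le hm k
  · rw [mem_vNumbers_iff h.one_lt, h.right, h.word.highSeq_zero]
    exact fun k _ => h.word.conj_shift_highSeq_le k

end GapPair

lemma GapWord.exists_right {M m : ℕ} {u : ℕ → ℕ} (h : GapWord M m u) :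
    ∃ q₂, 1 < q₂ ∧ qg q₂ = highSeq M m u :=
  exists_qg_eq h.isInfinite_highSeq h.shift_highSeq_le

lemma GapWord.exists_left {M m : ℕ} {u : ℕ → ℕ} (h : GapWord M m u) :
    ∃ q₁ : ℝ, (q₁ = 1 ∧ M = 1 ∧ m = 1) ∨ (1 < q₁ ∧ qg q₁ = lowSeq m u) := by
  by_cases hm : 2 ≤ m ∨ 2 ≤ M
  · obtain ⟨q, hq⟩ := exists_qg_eq (h.isInfinite_lowSeq hm) h.shift_lowSeq_le
    exact ⟨q, Or.inr hq⟩
  · have := h.length_pos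
    have := h.one_le
    exact ⟨1, Or.inl ⟨rfl, by omega, by omega⟩⟩

/-! ### Lexicographic characterization of unique expansions -/

/-- The first `n` elements of `c`, followed by the sequence `e`. -/
def append (n : ℕ) (c e : ℕ → ℕ) : ℕ → ℕ := fun i => if i < n then c i else e (i - n)

lemma tie_append (n : ℕ) (c e : ℕ → ℕ) : Tie n (append n c e) c := fun i hi => by
  simp [append, hi]

@[simp] lemma shift_append (n : ℕ) (c e : ℕ → ℕ) : shift n (append n c e) = e := by
  funext i; simp [append]

lemma shift_append_of_le {k n : ℕ} (h : k ≤ n) (c e : ℕ → ℕ) :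
    shift k (append n c e) = append (n - k) (shift k c) e := by
  funext i
  simp only [append, shift_apply]
  rcases lt_or_ge (k + i) n with h1 | h1
  · rw [if_pos h1, if_pos (by omega)]
  · rw [if_neg (by omega), if_neg (by omega)]
    congr 1; omega

lemma conj_append (M n : ℕ) (c e : ℕ → ℕ) :
    conj M (append n c e) = append n (conj M c) (conj M e) := by
  funext i
  simp only [append, conj_apply]
  split_ifs <;> rfl

lemma append_le {M n : ℕ} {c e : ℕ → ℕ} (hc : ∀ i, c i ≤ M) (he : ∀ i, e i ≤ M) (i : ℕ) :
    append n c e i ≤ M := by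
  unfold append
  split_ifs
  exacts [hc _, he _]

lemma shift_append_of_ge {k n : ℕ} (h : n ≤ k) (c e : ℕ → ℕ) :
    shift k (append n c e) = shift (k - n) e := by
  conv_lhs => rw [← Nat.add_sub_cancel' h, ← shift_shift, shift_append]

lemma append_lt {l : ℕ} {c e B : ℕ → ℕ} (h : PLt l c B ∨ Tie l c B ∧ e ≺ shift l B) :
    append l c e ≺ B := by
  rcases h with h | h
  · exact (h.congr (tie_append l c e).symm fun _ _ => rfl).lt
  · exact ((tie_append l c e).trans h.1).lt (by rw [shift_append]; exact h.2)

/-- The sequences in the alphabet `{0, …, M}` whose shifts after a digit `< M`, and whose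
reflected shifts after a digit `> 0`, are smaller than `B`. -/
def admissible (M : ℕ) (B : ℕ → ℕ) : Set (ℕ → ℕ) :=
  {c | (∀ i, c i ≤ M) ∧ (∀ n, c n < M → shift (n + 1) c ≺ B) ∧
    ∀ n, 0 < c n → conj M (shift (n + 1) c) ≺ B}

lemma conj_mem_admissible {M : ℕ} {B c : ℕ → ℕ} (hc : c ∈ admissible M B) :
    conj M c ∈ admissible M B := by
  refine ⟨conj_le M c, fun n hn => ?_, fun n hn => ?_⟩
  · rw [← conj_shift]
    simp only [conj_apply] at hn
    exact hc.2.2 n (by omega)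
  · rw [← conj_shift, conj_conj_shift hc.1]
    simp only [conj_apply] at hn
    exact hc.2.1 n (by omega)

/-- The weak bound comes from `val_shift_le_one`, applied at the positions following a digit below
`qg q 0`. Strictness comes from the positive tails of `qg q` after the first disagreement. -/
lemma val_shift_lt_one {q : ℝ} (hq : 1 < q) {c : ℕ → ℕ} (hc : c ∈ admissible (qg q 0) (qg q))
    {n : ℕ} (hn : c n < qg q 0) : val q (shift (n + 1) c) < 1 := by
  have hq0 : 0 < q := by linarith
  set P : ℕ → Prop := fun k => ∃ n, k = n + 1 ∧ c n < qg q 0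
  have key : ∀ k, P k → val q (shift k c) ≤ 1 := fun k hk =>
    val_shift_le_one hq (qg_le hq) hc.1 (P := P) (by rintro _ ⟨n, rfl, hn⟩; exact (hc.2.1 n hn).le)
      (fun k i h => ⟨k + i, rfl, h.trans_le (qg_le hq i)⟩) (val_qg hq).le hk
  obtain ⟨i, ht, hi⟩ := slt_iff.1 (hc.2.1 n hn)
  have e := val_sub_of_tie_succ hq (a := shift (n + 1) c) (fun i => hc.1 _) (qg_le hq) ht
  have hi' : (shift (n + 1) c i : ℝ) + 1 ≤ qg q i := by exact_mod_cast hi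
  have h1 := key (n + 1 + i + 1) ⟨n + 1 + i, rfl, hi.trans_le (qg_le hq i)⟩
  have h2 := val_shift_qg_pos hq (i + 1)
  rw [shift_shift, val_qg hq, ← add_assoc] at e
  have : val q (shift (n + 1) c) - 1 < 0 := by
    rw [e]
    exact div_neg_of_neg_of_pos (by linarith) (by positivity)
  linarith

lemma val_lt_of_slt_of_admissible {q : ℝ} (hq : 1 < q) {c d : ℕ → ℕ}
    (hc : c ∈ admissible (qg q 0) (qg q)) (hd : ∀ i, d i ≤ qg q 0) (h : c ≺ d) :
    val q c < val q d := by
  have hq0 : 0 < q := by linarith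
  obtain ⟨n, ht, hn⟩ := slt_iff.1 h
  have e := val_sub_of_tie_succ hq hd hc.1 ht.symm
  have hn' : (c n : ℝ) + 1 ≤ d n := by exact_mod_cast hn
  have h1 := val_shift_lt_one hq hc (hn.trans_le (hd n))
  have h2 := val_nonneg hq (shift (n + 1) d)
  have : 0 < val q d - val q c := by
    rw [e]
    exact div_pos (by linarith) (by positivity)
  linarith

lemma eq_of_val_eq {q : ℝ} (hq : 1 < q) {c d : ℕ → ℕ}
    (hc : c ∈ admissible (qg q 0) (qg q)) (hd : ∀ i, d i ≤ qg q 0) (h : val q d = val q c) :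
    d = c := by
  rcases slt_trichotomy d c with h1 | h1 | h1
  · have := val_lt_of_slt_of_admissible hq (conj_mem_admissible hc) (conj_le _ d) (h1.conj hc.1)
    rw [val_conj hq hc.1, val_conj hq hd, h] at this
    exact absurd this (lt_irrefl _)
  · exact h1
  · exact absurd h (val_lt_of_slt_of_admissible hq hc hd h1).ne'

/-- A tail not below `qg q` has value at least `1`. One unit can then be carried into the preceding
digit and the rest of the tail expanded anew, which gives a second expansion. -/
lemma shift_slt_of_unique {q : ℝ} (hq : 1 < q) {c : ℕ → ℕ} (hc : ∀ i, c i ≤ qg q 0)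
    (hu : ∀ d : ℕ → ℕ, (∀ i, d i ≤ qg q 0) → val q d = val q c → d = c) {n : ℕ}
    (hn : c n < qg q 0) : shift (n + 1) c ≺ qg q := by
  have hq0 : 0 < q := by linarith
  by_contra hlt
  have h1 : 1 ≤ val q (shift (n + 1) c) := by
    rcases (not_slt.1 hlt).eq_or_lt with h | h
    · rw [← h, val_qg hq]
    · obtain ⟨i, hi⟩ := val_le_of_slt hq (a := shift (n + 1) c) (fun i => hc _) (qg_le hq)
        (fun n => val_shift_qg_le hq _) h
      rw [val_qg hq] at hi
      have : 0 ≤ val q (shift (i + 1) (shift (n + 1) c)) / q ^ (i + 1) :=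
        div_nonneg (val_nonneg hq _) (by positivity)
      linarith
  have h2 := val_le hq (c := shift (n + 1) c) (fun i => hc _)
  obtain ⟨e, he, hv⟩ := exists_expansion hq (le_qg_zero hq)
    (x := val q (shift (n + 1) c) - 1) (by linarith) (by linarith)
  set d := append n c (append 1 (fun _ => c n + 1) e) with hd
  have hd1 : shift (n + 1) d = e := by rw [← shift_shift, hd, shift_append, shift_append]
  have hdn : d n = c n + 1 := by simp [hd, append]
  have hdle : ∀ i, d i ≤ qg q 0 := append_le hc (append_le (fun _ => hn) he)
  have hval : val q d = val q c := by
    rw [← sub_eq_zero, val_sub_of_tie_succ hq hdle hc (tie_append n c _), hd1, hv, hdn]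
    push_cast
    ring
  have := hu d hdle hval
  rw [this] at hdn
  omega

lemma mem_univoqueSet_iff {q : ℝ} (hq : 1 < q) {x : ℝ} :
    x ∈ univoqueSet q ↔ ∃ c ∈ admissible (qg q 0) (qg q), val q c = x := by
  constructor
  · rintro ⟨c, hc, hu⟩
    rw [isExpansion_iff hq] at hc
    obtain ⟨hc, rfl⟩ := hc
    have hu' : ∀ d : ℕ → ℕ, (∀ i, d i ≤ qg q 0) → val q d = val q c → d = c := fun d hd h =>
      hu d ((isExpansion_iff hq).2 ⟨hd, h⟩)
    refine ⟨c, ⟨hc, fun n hn => shift_slt_of_unique hq hc hu' hn, fun n hn => ?_⟩, rfl⟩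
    rw [conj_shift]
    refine shift_slt_of_unique hq (conj_le _ c) (fun d hd h => ?_) ?_
    · have : conj (qg q 0) d = c := hu' _ (conj_le _ d) (by
        rw [val_conj hq hd, h, val_conj hq hc]; ring)
      rw [← this, conj_conj hd]
    · have := hc n
      simp only [conj_apply]
      omega
  · rintro ⟨c, hc, rfl⟩
    refine ⟨c, (isExpansion_iff hq).2 ⟨hc.1, rfl⟩, fun d hd => ?_⟩
    have hd := (isExpansion_iff hq).1 hd
    exact eq_of_val_eq hq hc hd.1 hd.2

/-! ### The sets `𝒰`, `𝒱` and the closure of `𝒰` -/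

lemma mem_univoqueNumbers_iff {q : ℝ} (hq : 1 < q) :
    q ∈ univoqueNumbers ↔ qg q ∈ admissible (qg q 0) (qg q) := by
  constructor
  · rintro ⟨-, h⟩
    obtain ⟨c, hc, h⟩ := (mem_univoqueSet_iff hq).1 h
    have e := eq_of_val_eq hq hc (qg_le hq) (by rw [h, val_qg hq])
    rwa [← e] at hc
  · intro h
    exact ⟨hq, (mem_univoqueSet_iff hq).2 ⟨_, h, val_qg hq⟩⟩

/-- The bases for which the reflected proper shifts of the quasi-greedy expansion of `1` are
smaller than this expansion. -/
def wNumbers : Set ℝ := {q | 1 < q ∧ ∀ k, 1 ≤ k → conj (qg q 0) (shift k (qg q)) ≺ qg q}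

lemma wNumbers_subset_vNumbers : wNumbers ⊆ vNumbers := fun _ hq =>
  (mem_vNumbers_iff hq.1).2 fun k hk => (hq.2 k hk).le

/-- Admissibility gives the inequality only after a positive digit. A zero digit reflects to the
first digit of `qg q`, so the inequality at the preceding position can be shifted by one. -/
lemma univoqueNumbers_subset_wNumbers : univoqueNumbers ⊆ wNumbers := by
  intro q hq
  have hq1 := hq.1
  rw [mem_univoqueNumbers_iff hq1] at hq
  refine ⟨hq1, fun k hk => ?_⟩
  induction k, hk using Nat.le_induction with
  | base => exact hq.2.2 0 (qg_zero_pos hq1)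
  | succ n hn ih =>
    rcases Nat.eq_zero_or_pos (qg q n) with h | h
    · have ht : Tie 1 (conj (qg q 0) (shift n (qg q))) (qg q) := fun i hi => by
        obtain rfl : i = 0 := by omega
        simp [h]
      have := ht.shift_lt ih
      rw [← conj_shift, shift_shift] at this
      exact this.trans_le (shift_qg_le hq1 1)
    · exact hq.2.2 n h

lemma mem_univoqueNumbers_of_forall_ne {q : ℝ} (hq : q ∈ wNumbers)
    (h : ∀ k, 1 ≤ k → shift k (qg q) ≠ qg q) : q ∈ univoqueNumbers :=
  (mem_univoqueNumbers_iff hq.1).2 ⟨qg_le hq.1,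
    fun n _ => (shift_qg_le hq.1 _).lt_of_ne (h _ (by omega)), fun n _ => hq.2 _ (by omega)⟩

lemma integersFrom_subset_univoqueNumbers : integersFrom 2 ⊆ univoqueNumbers := by
  rintro _ ⟨n, hn, rfl⟩
  obtain ⟨M, rfl⟩ := Nat.exists_eq_add_of_le' (show 1 ≤ n by omega)
  have hM : 1 ≤ M := by omega
  rw [mem_univoqueNumbers_iff (by exact_mod_cast hn), qg_natCast hM]
  refine ⟨fun _ => le_rfl, fun _ h => absurd h (lt_irrefl _), fun _ _ => slt_of_apply_zero ?_⟩
  simp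
  omega

/-- Some inequality must be an equality; if it involves a reflection, applying it twice gives a
period. -/
lemma exists_shift_eq_of_not_mem {q : ℝ} (hV : q ∈ vNumbers) (hU : q ∉ univoqueNumbers) :
    ∃ k, 1 ≤ k ∧ shift k (qg q) = qg q := by
  have hq := hV.1
  by_contra! h
  have hW : q ∉ wNumbers := fun hW => hU (mem_univoqueNumbers_of_forall_ne hW h)
  have : ∃ k, 1 ≤ k ∧ conj (qg q 0) (shift k (qg q)) = qg q := by
    by_contra! h'
    exact hW ⟨hq, fun k hk => ((mem_vNumbers_iff hq).1 hV k hk).lt_of_ne (h' k hk)⟩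
  obtain ⟨k, hk, e⟩ := this
  refine h (k + k) (by omega) ?_
  have e1 : shift k (qg q) = conj (qg q 0) (qg q) := by
    rw [← conj_conj_shift (qg_le hq) k, e]
  rw [← shift_shift, e1, ← conj_shift, e]

lemma mem_integersFrom_of_shift_one {q : ℝ} (hq : 1 < q) (h : shift 1 (qg q) = qg q) :
    q ∈ integersFrom 2 := by
  have hM := qg_zero_pos hq
  refine ⟨qg q 0 + 1, by omega, qg_injective hq (by exact_mod_cast Nat.lt_succ_of_le hM) ?_⟩
  rw [qg_natCast hM]
  funext i
  rw [apply_mod_of_periodic h, Nat.mod_one]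

/-! ### Words defining gaps, from quasi-greedy expansions -/

lemma ple_of_plt_of_le_succ {l : ℕ} {a a' b : ℕ → ℕ} (h : PLt (l + 1) a b) (ht : Tie l a' a)
    (hl : a' l ≤ a l + 1) : PLe (l + 1) a' b := by
  obtain ⟨i, hi, h1, h2⟩ := h
  rcases Nat.lt_or_ge i l with hil | hil
  · exact Or.inl ⟨i, hi, (ht.mono hil.le).trans h1, ht i hil ▸ h2⟩
  · obtain rfl : i = l := by omega
    rcases (show a' i < b i ∨ a' i = b i by omega) with h3 | h3
    · exact Or.inl ⟨i, hi, ht.trans h1, h3⟩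
    · refine Or.inr fun j hj => ?_
      rcases Nat.lt_or_ge j i with hji | hji
      · rw [ht j hji, h1 j hji]
      · obtain rfl : j = i := by omega
        exact h3

lemma plt_of_ple_of_lt {l : ℕ} {a a' b : ℕ → ℕ} (h : PLe (l + 1) a b) (ht : Tie l a' a)
    (hl : a' l < a l) : PLt (l + 1) a' b :=
  PLt.trans_le ⟨l, l.lt_succ_self, ht, hl⟩ h

/-- The prefix of length `m` of `a`, followed by zeros. -/
def trunc (m : ℕ) (a : ℕ → ℕ) : ℕ → ℕ := append m a fun _ => 0

/-- The prefix of length `m` of `a` with its last digit increased, followed by zeros. -/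
def incr (m : ℕ) (a : ℕ → ℕ) : ℕ → ℕ :=
  append (m - 1) a (append 1 (fun _ => a (m - 1) + 1) fun _ => 0)

lemma incr_last (m : ℕ) (a : ℕ → ℕ) : incr m a (m - 1) = a (m - 1) + 1 := by
  simp [incr, append]

lemma tie_incr (m : ℕ) (a : ℕ → ℕ) : Tie (m - 1) (incr m a) a := tie_append _ _ _

lemma tie_trunc (m : ℕ) (a : ℕ → ℕ) : Tie m (trunc m a) a := tie_append _ _ _

lemma gapWord_trunc {M m : ℕ} {a : ℕ → ℕ} (hm : 0 < m) (hM : 1 ≤ M) (h0 : a 0 = M)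
    (hs : ∀ k, shift k a ≼ a) (hlast : 0 < a (m - 1))
    (hgood : ∀ k, 0 < k → k < m → PLt (m - k) (conj M (shift k a)) a) :
    GapWord M m (trunc m a) where
  length_pos := hm
  one_le := hM
  zero := by rw [tie_trunc m a 0 hm, h0]
  le := append_le (fun i => h0 ▸ le_apply_zero_of_shift_le hs i) fun _ => Nat.zero_le _
  last := by rwa [tie_trunc m a _ (by omega)]
  tail := fun i hi => by simp [trunc, append, not_lt.2 hi]
  suffix_le := fun k hk hkm => ((hs k).ple _).congr
    (fun i hi => (tie_trunc m a (k + i) (by omega)).symm) ((tie_trunc m a).mono (by omega)).symm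
  conj_suffix_lt := fun k hk hkm => (hgood k hk hkm).congr
    (Tie.conj fun i hi => (tie_trunc m a (k + i) (by omega)).symm)
    ((tie_trunc m a).mono (by omega)).symm

/-- Raising the last digit weakens the strict suffix inequalities and makes the weak reflected ones
strict, so strictness is required of the suffixes here, and of the reflected suffixes in
`gapWord_trunc`. -/
lemma gapWord_incr {M m : ℕ} {a : ℕ → ℕ} (hm : 0 < m) (hM : 1 ≤ M) (h0 : a 0 = M)
    (hs : ∀ k, shift k a ≼ a) (hV : ∀ k, 1 ≤ k → conj M (shift k a) ≼ a) (hlast : a (m - 1) < M)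
    (hgood : ∀ k, 0 < k → k < m → PLt (m - k) (shift k a) a) :
    GapWord M m (incr m a) := by
  have hm2 : m ≠ 1 := by rintro rfl; rw [Nat.sub_self] at hlast; omega
  have hle : ∀ i, a i ≤ M := fun i => h0 ▸ le_apply_zero_of_shift_le hs i
  refine ⟨hm, hM, by rw [tie_incr m a 0 (by omega), h0],
    append_le hle (append_le (fun _ => hlast) fun _ => Nat.zero_le _), ?_, ?_, ?_, ?_⟩
  · rw [incr_last]; omega
  · intro i hi
    simp only [incr, append]
    rw [if_neg (by omega), if_neg (by omega)]
  · intro k hk hkm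
    obtain ⟨l, hl⟩ := Nat.exists_eq_add_of_lt hkm
    have e : m - k = l + 1 := by omega
    have e' : k + l = m - 1 := by omega
    have h := hgood k hk hkm
    rw [e] at h ⊢
    refine (ple_of_plt_of_le_succ h (a' := shift k (incr m a)) (fun i hi => ?_) ?_).congr
      (fun _ _ => rfl) ((tie_incr m a).mono (by omega)).symm
    · exact tie_incr m a (k + i) (by omega)
    · rw [shift_apply, shift_apply, e', incr_last]
  · intro k hk hkm
    obtain ⟨l, hl⟩ := Nat.exists_eq_add_of_lt hkm
    have e : m - k = l + 1 := by omega
    have e' : k + l = m - 1 := by omega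
    have h := (hV k hk).ple (m - k)
    rw [e] at h ⊢
    refine (plt_of_ple_of_lt h (a' := conj M (shift k (incr m a))) (Tie.conj fun i hi => ?_)
      ?_).congr (fun _ _ => rfl) ((tie_incr m a).mono (by omega)).symm
    · exact tie_incr m a (k + i) (by omega)
    · simp only [conj_apply, shift_apply, e', incr_last]
      omega

lemma tie_lowSeq_trunc (m : ℕ) (a : ℕ → ℕ) : Tie (m - 1) (lowSeq m (trunc m a)) a :=
  GapWord.tie_lowSeq.trans ((tie_trunc m a).mono (by omega))

lemma tie_lowSeq_incr {m : ℕ} (hm : 0 < m) (a : ℕ → ℕ) : Tie m (lowSeq m (incr m a)) a := by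
  intro i hi
  rcases Nat.lt_or_ge i (m - 1) with h | h
  · rw [GapWord.lowSeq_apply_of_lt h, tie_incr m a i h]
  · obtain rfl : i = m - 1 := by omega
    rw [GapWord.lowSeq_last hm, incr_last, Nat.add_sub_cancel]

/-- Every element of `𝒱 \ 𝒰` is the left endpoint of a gap. -/
lemma exists_gapPair_of_mem_diff {q : ℝ} (hV : q ∈ vNumbers) (hU : q ∉ univoqueNumbers) :
    ∃ m u q₂, GapPair (qg q 0) m u q q₂ := by
  classical
  have hq := hV.1
  have hex := exists_shift_eq_of_not_mem hV hU
  obtain ⟨hm, hper⟩ := Nat.find_spec hex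
  have hmin := fun k (hk : k < Nat.find hex) => Nat.find_min hex hk
  set m := Nat.find hex
  -- If the period ended in the largest digit, deleting it from the shift by `m - 1` would show that
  -- `qg q` is at most its shift by one, hence constant, and `q` would be an integer, an element of
  -- `𝒰`.
  have hlast : qg q (m - 1) < qg q 0 := by
    refine (qg_le hq _).lt_of_ne fun e => ?_
    have ht : Tie 1 (shift (m - 1) (qg q)) (qg q) := fun i hi => by
      obtain rfl : i = 0 := by omega
      rw [shift_apply, add_zero, e]
    have h1 := ht.shift_le (shift_qg_le hq _)
    rw [shift_shift, Nat.sub_add_cancel hm, hper] at h1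
    exact hU (integersFrom_subset_univoqueNumbers
      (mem_integersFrom_of_shift_one hq ((shift_qg_le hq 1).antisymm h1)))
  have hgood : ∀ k, 0 < k → k < m → PLt (m - k) (shift k (qg q)) (qg q) := by
    intro k hk hkm
    have hlt : ∀ k, 0 < k → k < m → shift k (qg q) ≺ qg q := fun k hk hkm =>
      (shift_qg_le hq k).lt_of_ne fun e => hmin k hkm ⟨hk, e⟩
    refine ((hlt k hk hkm).cases (m - k)).resolve_right fun h => ?_
    have h2 := h.2
    rw [shift_shift, Nat.add_sub_cancel' hkm.le, hper] at h2
    exact SLt.irrefl _ (h2.trans_le (shift_qg_le hq _))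
  have hw : GapWord (qg q 0) m (incr m (qg q)) := gapWord_incr hm (qg_zero_pos hq) rfl
    (shift_qg_le hq) ((mem_vNumbers_iff hq).1 hV) hlast hgood
  obtain ⟨q₂, h2, e2⟩ := hw.exists_right
  exact ⟨m, _, q₂, hw, Or.inr ⟨hq, (Tie.eq_of_periodic hm (GapWord.shift_lowSeq _ _) hper
    (tie_lowSeq_incr hm _)).symm⟩, h2, e2⟩

lemma eq_of_shift_eq_conj {M m : ℕ} {a b : ℕ → ℕ} (hm : 0 < m) (ha : shift m a = conj M a)
    (hb : shift m b = conj M b) (h : Tie m a b) : a = b := by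
  funext i
  induction i using Nat.strong_induction_on with
  | _ i ih =>
    rcases lt_or_ge i m with hi | hi
    · exact h i hi
    · have h1 := congrFun ha (i - m)
      have h2 := congrFun hb (i - m)
      simp only [shift_apply, conj_apply, Nat.add_sub_cancel' hi] at h1 h2
      rw [h1, h2, ih (i - m) (by omega)]

/-- Every element of `𝒱` not satisfying the strict inequalities is the right endpoint of a gap. -/
lemma exists_gapPair_right {q : ℝ} (hV : q ∈ vNumbers) (hW : q ∉ wNumbers) :
    ∃ m u q₁, GapPair (qg q 0) m u q₁ q := by
  classical
  have hq := hV.1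
  have hle := qg_le hq
  have hVq := (mem_vNumbers_iff hq).1 hV
  have hex : ∃ k, 1 ≤ k ∧ conj (qg q 0) (shift k (qg q)) = qg q := by
    by_contra! h'
    exact hW ⟨hq, fun k hk => (hVq k hk).lt_of_ne (h' k hk)⟩
  obtain ⟨hm, hper⟩ := Nat.find_spec hex
  have hmin := fun k (hk : k < Nat.find hex) => Nat.find_min hex hk
  set m := Nat.find hex
  have hper' : shift m (qg q) = conj (qg q 0) (qg q) := by
    rw [← conj_conj_shift hle m, hper]
  -- A tie on `m - k` digits would leave `qg q` on one side and one of its shifts on the other;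
  -- these must coincide, contradicting the minimality of `m`.
  have hgood : ∀ k, 0 < k → k < m → PLt (m - k) (conj (qg q 0) (shift k (qg q))) (qg q) := by
    intro k hk hkm
    refine ((hVq k hk).cases (m - k)).resolve_right fun ⟨ht, h2⟩ => hmin k hkm ⟨hk, ?_⟩
    rw [← conj_shift, shift_shift, Nat.add_sub_cancel' hkm.le, hper] at h2
    refine ht.eq ?_
    rw [← conj_shift, shift_shift, Nat.add_sub_cancel' hkm.le, hper]
    exact h2.antisymm (shift_qg_le hq _)
  have hlast : 0 < qg q (m - 1) := by
    by_contra h0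
    have h0 : qg q (m - 1) = 0 := by omega
    have hm1 : m ≠ 1 := by
      intro e
      rw [e] at h0
      have := qg_zero_pos hq
      simp only [Nat.sub_self] at h0
      omega
    obtain ⟨i, hi, -, h⟩ := hgood (m - 1) (by omega) (by omega)
    obtain rfl : i = 0 := by omega
    simp [h0] at h
  have hw : GapWord (qg q 0) m (trunc m (qg q)) := gapWord_trunc hm (qg_zero_pos hq) rfl
    (shift_qg_le hq) hlast hgood
  obtain ⟨q₁, h1⟩ := hw.exists_left
  exact ⟨m, _, q₁, hw, h1, hq, eq_of_shift_eq_conj hm hper' hw.shift_highSeq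
    (GapWord.tie_highSeq.trans (tie_trunc _ _)).symm⟩

/-- Every positive integer is the left endpoint of a gap. -/
lemma exists_gapPair_of_nat {M : ℕ} (hM : 1 ≤ M) :
    ∃ q₂, GapPair M 1 (trunc 1 fun _ => M) M q₂ := by
  have hw : GapWord M 1 (trunc 1 fun _ => M) := gapWord_trunc one_pos hM rfl
    (fun _ => SLe.refl _) hM fun k hk hk1 => by omega
  obtain ⟨q₂, h2, e2⟩ := hw.exists_right
  refine ⟨q₂, hw, ?_, h2, e2⟩
  -- The one-letter word `M` lives over `{0, …, M}`, one digit more than base `M` uses: its `lowSeq`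
  -- is `(M - 1)^∞`, the expansion in base `M`.
  rcases hM.eq_or_lt with rfl | hM'
  · exact Or.inl ⟨by simp, rfl, rfl⟩
  · refine Or.inr ⟨by exact_mod_cast hM', ?_⟩
    have := qg_natCast (M := M - 1) (by omega)
    rw [Nat.sub_add_cancel hM] at this
    rw [this, hw.lowSeq_one]

/-! ### Approximations -/

/-- Arbitrarily long prefixes of the quasi-greedy expansion in a base of `wNumbers` satisfy the
strict inequalities as words. -/
lemma exists_good_prefix {q : ℝ} (hq : q ∈ wNumbers) (n : ℕ) :
    ∃ m, n ≤ m ∧ 2 ≤ m ∧ GapWord (qg q 0) m (trunc m (qg q)) := by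
  have hq1 := hq.1
  obtain ⟨m, hm, h⟩ := exists_forall_plt (c := conj (qg q 0) (qg q)) (P := fun k => 1 ≤ k)
    (shift_qg_le hq1) hq.2 (n + 2)
  refine ⟨m, by omega, by omega, gapWord_trunc (by omega) (qg_zero_pos hq1) rfl (shift_qg_le hq1)
    ?_ fun k hk hkm => h k hkm hk⟩
  obtain ⟨i, hi, -, h'⟩ := h (m - 1) (by omega) (by omega)
  obtain rfl : i = 0 := by omega
  simp only [shift_apply, conj_apply, add_zero] at h'
  omega

/-- The periodic sequences `(w⁻)^∞`, for long good prefixes `w`, serve both as expansions of nearby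
elements of `𝒱` and as tails for gluing. -/
lemma exists_low_approx {q : ℝ} (hq : q ∈ wNumbers) (n : ℕ) :
    ∃ e : ℕ → ℕ, (∀ i, e i ≤ qg q 0) ∧ IsInfinite e ∧ Tie n e (qg q) ∧ e ≺ qg q ∧ e 0 = qg q 0 ∧
      ∀ k, shift k e ≼ e ∧ conj (qg q 0) (shift k e) ≼ e := by
  obtain ⟨m, hn, hm, hw⟩ := exists_good_prefix hq (n + 1)
  refine ⟨lowSeq m (trunc m (qg q)), hw.lowSeq_le, hw.isInfinite_lowSeq (Or.inl hm),
    (tie_lowSeq_trunc _ _).mono (by omega), ?_, ?_, fun k =>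
    ⟨hw.shift_lowSeq_le k, hw.conj_shift_lowSeq_le hm k⟩⟩
  · exact (hw.plt_lowSeq.congr (fun _ _ => rfl) (tie_trunc _ _)).lt
  · exact tie_lowSeq_trunc _ _ 0 (by omega)

/-- Elements of `wNumbers` are limits from the left of elements of `𝒱`. -/
lemma exists_vNumbers_left {q : ℝ} (hq : q ∈ wNumbers) {x : ℝ} (hx : x < q) :
    ∃ p ∈ vNumbers, p ∈ Ioo x q := by
  obtain ⟨n, hn⟩ := exists_tie_dist_lt hq.1 (sub_pos.2 hx)
  obtain ⟨e, -, hi, ht, hlt, h0, hs⟩ := exists_low_approx hq n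
  obtain ⟨p, hp, rfl⟩ := exists_qg_eq hi fun k => (hs k).1
  have h1 := (abs_lt.1 (hn p hp n le_rfl ht)).1
  refine ⟨p, (mem_vNumbers_iff hp).2 fun k _ => ?_, by linarith, (qg_slt_qg_iff hp hq.1).1 hlt⟩
  rw [h0]
  exact (hs k).2

/-- Non-integer elements of `𝒰` are limits from the right of elements of `𝒱`. -/
lemma exists_vNumbers_right {q : ℝ} (hq : q ∈ univoqueNumbers) (hN : q ∉ integersFrom 2) {x : ℝ}
    (hx : q < x) : ∃ p ∈ vNumbers, p ∈ Ioo q x := by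
  have hW := univoqueNumbers_subset_wNumbers hq
  have hq1 := hq.1
  rw [mem_univoqueNumbers_iff hq1] at hq
  obtain ⟨n, hn⟩ := exists_tie_dist_lt hq1 (sub_pos.2 hx)
  have hlt : ∀ k, 1 ≤ k → shift k (qg q) ≺ qg q := by
    intro k hk
    refine (shift_qg_le hq1 k).lt_of_ne fun e => ?_
    obtain ⟨k, rfl⟩ := Nat.exists_eq_add_of_le' hk
    rcases (qg_le hq1 k).lt_or_eq with h | h
    · exact SLt.irrefl _ (e ▸ hq.2.1 k h)
    · have ht : Tie 1 (shift k (qg q)) (qg q) := fun i hi => by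
        obtain rfl : i = 0 := by omega
        rw [shift_apply, add_zero, h]
      have h1 := ht.shift_le (shift_qg_le hq1 _)
      rw [shift_shift, e] at h1
      exact hN (mem_integersFrom_of_shift_one hq1 ((shift_qg_le hq1 1).antisymm h1))
  obtain ⟨m, hm, h⟩ := exists_forall_plt (P := fun k => 1 ≤ k) (shift_qg_le hq1) hlt (n + 2)
  have hlast : qg q (m - 1) < qg q 0 := by
    obtain ⟨i, hi, -, h'⟩ := h (m - 1) (by omega) (by omega)
    obtain rfl : i = 0 := by omega
    simpa using h'
  have hw : GapWord (qg q 0) m (incr m (qg q)) := gapWord_incr (by omega) (qg_zero_pos hq1) rfl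
    (shift_qg_le hq1) (fun k hk => (hW.2 k hk).le) hlast fun k hk hkm => h k hkm hk
  obtain ⟨p, hp, hpe⟩ := hw.exists_right
  have ht : Tie (m - 1) (qg p) (qg q) := by
    rw [hpe]
    exact (GapWord.tie_highSeq.mono (by omega)).trans (tie_incr _ _)
  have h1 := (abs_lt.1 (hn p hp (m - 1) (by omega) ht)).2
  refine ⟨p, (mem_vNumbers_iff hp).2 fun k _ => ?_, ?_, by linarith⟩
  · rw [hpe, hw.highSeq_zero]
    exact hw.conj_shift_highSeq_le k
  · rw [← qg_slt_qg_iff hq1 hp]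
    refine PLt.lt (l := m) ⟨m - 1, by omega, ht.symm, ?_⟩
    rw [hpe, GapWord.tie_highSeq _ (by omega), incr_last]
    omega

/-- For a word `w` defining a gap, the sequence consisting of `w` followed by the periodic
repetition of the reflection of `w` with decreased last digit. -/
lemma GapWord.exists_univoqueNumbers {M m : ℕ} {u : ℕ → ℕ} (h : GapWord M m u) (hm : 2 ≤ m) :
    ∃ p ∈ univoqueNumbers, Tie m (qg p) u := by
  set e := lowSeq m u with he
  have hle : ∀ i, e i ≤ M := h.lowSeq_le
  set c := append m u (conj M e) with hc
  have hcle : ∀ i, c i ≤ M := append_le h.le (conj_le M e)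
  have ht : Tie m c u := tie_append _ _ _
  have he_u : Tie (m - 1) e u := tie_lowSeq
  have hue : ∀ k, 0 < k → k < m → Tie k u e := fun k hk hkm => (he_u.mono (by omega)).symm
  have hc0 : c 0 = M := by rw [ht 0 h.length_pos, h.zero]
  -- the reflections of prefixes are smaller than the suffixes
  have hpre : ∀ k, 0 < k → k < m → PLt k (conj M u) (shift (m - k) u) := by
    intro k hk hkm
    have h1 := (h.conj_suffix_lt (m - k) (by omega) (by omega)).conj h.le
    rwa [conj_conj_shift h.le, show m - (m - k) = k by omega] at h1
  have hs : ∀ k, 1 ≤ k → shift k c ≺ c := by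
    intro k hk
    rcases lt_or_ge k m with hkm | hkm
    · rw [hc, shift_append_of_le hkm.le]
      refine append_lt ?_
      have h1 := (h.suffix_le k hk hkm).congr (fun _ _ => rfl) (ht.mono (by omega)).symm
      -- After a tie, the reflected prefix of length `k` meets the suffix of `u` of the same length,
      -- and `hpre` decides.
      refine h1.imp id fun h1 => ⟨h1, ?_⟩
      rw [shift_append_of_le (by omega)]
      have h2 := hpre k hk hkm
      have h3 : PLt k (conj M e) (append (m - (m - k)) (shift (m - k) u) (conj M e)) :=
        h2.congr (Tie.conj (hue k hk hkm))
          ((tie_append _ _ _).mono (by omega)).symm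
      exact h3.lt
    · rw [hc, shift_append_of_ge hkm, ← hc, ← conj_shift,
        shift_mod_of_periodic (shift_lowSeq m u)]
      set j := (k - m) % m
      have hj : j < m := Nat.mod_lt _ h.length_pos
      rcases Nat.eq_zero_or_pos j with hj0 | hj0
      · rw [hj0, shift_zero]
        refine slt_of_apply_zero ?_
        rw [conj_apply, h.lowSeq_zero hm, hc0]
        have := h.one_le
        omega
      · have h1 := (h.conj_shift_lowSeq_ple hj0 hj).congr (fun _ _ => rfl)
          ((he_u.mono (by omega)).trans (ht.mono (by omega)).symm)
        rcases h1 with h1 | h1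
        · exact h1.lt
        · refine h1.lt ?_
          rw [← conj_shift, shift_shift, Nat.add_sub_cancel' hj.le, shift_lowSeq,
            hc, shift_append_of_le (by omega)]
          have h3 : PLt j (conj M e) (append (m - (m - j)) (shift (m - j) u) (conj M e)) :=
            (hpre j hj0 hj).congr (Tie.conj (hue j hj0 hj))
              ((tie_append _ _ _).mono (by omega)).symm
          exact h3.lt
  have hsc : ∀ k, 1 ≤ k → conj M (shift k c) ≺ c := by
    intro k hk
    rcases lt_or_ge k m with hkm | hkm
    · refine ((h.conj_suffix_lt k hk hkm).congr (Tie.conj fun i hi => ?_)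
        (ht.mono (by omega)).symm).lt
      exact (ht (k + i) (by omega)).symm
    · rw [hc, shift_append_of_ge hkm, ← hc, ← conj_shift, conj_conj_shift hle,
        shift_mod_of_periodic (shift_lowSeq m u)]
      refine (h.shift_lowSeq_le _).trans_lt ?_
      exact (h.plt_lowSeq.congr (fun _ _ => rfl) ht.symm).lt
  have hinf : IsInfinite c := by
    rw [isInfinite_iff]
    intro n
    have h1 := h.last
    have h2 := h.le (m - 1)
    refine ⟨m * n - n + (m + (m - 1)), ?_⟩
    have h3 : n ≤ m * n := Nat.le_mul_of_pos_left n h.length_pos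
    have h4 : c (n + (m * n - n + (m + (m - 1)))) = shift (m + m * n) c (m - 1) := by
      rw [shift_apply]; congr 1; omega
    rw [h4, hc, shift_append_of_ge (by omega), Nat.add_sub_cancel_left, ← conj_shift,
      shift_mul_of_periodic (shift_lowSeq m u), conj_apply, lowSeq_last h.length_pos]
    omega
  have hs' : ∀ k, shift k c ≼ c := fun k => by
    rcases Nat.eq_zero_or_pos k with rfl | hk
    · rw [shift_zero]; exact SLe.refl _
    · exact (hs k hk).le
  obtain ⟨p, hp, hpc⟩ := exists_qg_eq hinf hs'
  refine ⟨p, (mem_univoqueNumbers_iff hp).2 ?_, hpc ▸ ht⟩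
  rw [hpc, hc0]
  exact ⟨hcle, fun n _ => hs _ (by omega), fun n _ => hsc _ (by omega)⟩

lemma wNumbers_subset_closure : wNumbers ⊆ closure univoqueNumbers := by
  intro q hq
  refine Metric.mem_closure_iff.2 fun ε hε => ?_
  obtain ⟨n, hn⟩ := exists_tie_dist_lt hq.1 hε
  obtain ⟨m, hnm, hm, hw⟩ := exists_good_prefix hq n
  obtain ⟨p, hp, ht⟩ := hw.exists_univoqueNumbers hm
  refine ⟨p, hp, ?_⟩
  rw [dist_comm, Real.dist_eq]
  exact hn p hp.1 m hnm (ht.trans (tie_trunc _ _))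

/-! ### The set `𝒱` is closed in `(1, ∞)` -/

lemma isOpen_slt : IsOpen {p : (ℕ → ℕ) × (ℕ → ℕ) | p.1 ≺ p.2} := by
  have h : {p : (ℕ → ℕ) × (ℕ → ℕ) | p.1 ≺ p.2} =
      ⋃ i, (⋂ j ∈ Finset.range i, {p | p.1 j = p.2 j}) ∩ {p | p.1 i < p.2 i} := by
    ext p
    simp only [mem_ofPred_eq, slt_iff, mem_iUnion, mem_inter_iff, mem_iInter, Finset.mem_range,
      Tie]
  rw [h]
  refine isOpen_iUnion fun i => (isOpen_biInter_finset fun j _ => ?_).inter ?_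
  · exact (isOpen_discrete {x : ℕ × ℕ | x.1 = x.2}).preimage
      (f := fun p : (ℕ → ℕ) × (ℕ → ℕ) => (p.1 j, p.2 j)) (by fun_prop)
  · exact (isOpen_discrete {x : ℕ × ℕ | x.1 < x.2}).preimage
      (f := fun p : (ℕ → ℕ) × (ℕ → ℕ) => (p.1 i, p.2 i)) (by fun_prop)

lemma isClosed_sle : IsClosed {p : (ℕ → ℕ) × (ℕ → ℕ) | p.1 ≼ p.2} := by
  have h : {p : (ℕ → ℕ) × (ℕ → ℕ) | p.1 ≼ p.2} = Prod.swap ⁻¹' {p | p.1 ≺ p.2}ᶜ := by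
    ext p
    simp [not_slt]
  rw [h]
  exact isOpen_slt.isClosed_compl.preimage continuous_swap

lemma continuous_shift (k : ℕ) : Continuous (shift k) := by
  unfold shift; fun_prop

lemma continuous_conj_apply_zero (k : ℕ) :
    Continuous fun a : ℕ → ℕ => conj (a 0) (shift k a) := by
  refine continuous_pi fun i => ?_
  have h : Continuous fun x : ℕ × ℕ => x.1 - x.2 := continuous_of_discreteTopology
  exact h.comp (f := fun a : ℕ → ℕ => (a 0, a (k + i))) (by fun_prop)

lemma isCompact_le (M : ℕ) : IsCompact {a : ℕ → ℕ | ∀ i, a i ≤ M} := by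
  have h := isCompact_univ_pi (s := fun _ : ℕ => Iic M) fun _ => (finite_Iic M).isCompact
  convert h using 1
  ext a; simp [Pi.le_def]

/-- A zero tail would reflect to the constant `a 0`, the largest sequence available, and force `a`
to be constant. This recovers infinitude, which does not pass to limits by itself. -/
lemma isInfinite_of_conj_shift_le {a : ℕ → ℕ} (h0 : a 0 ≠ 0)
    (hs : ∀ k, 1 ≤ k → conj (a 0) (shift k a) ≼ a) (hle : ∀ i, a i ≤ a 0) : IsInfinite a := by
  refine isInfinite_iff.2 fun n => ?_
  by_contra! h
  have h1 := hs (n + 1) (by omega)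
  have h2 : conj (a 0) (shift (n + 1) a) = fun _ => a 0 := by
    funext i
    have := h (1 + i)
    simp [add_assoc, this]
  rw [h2] at h1
  have h3 := h 0
  rcases h1.eq_or_lt with h4 | h4
  · have := congrFun h4 (n + 0)
    omega
  · obtain ⟨i, -, hi⟩ := slt_iff.1 h4
    have := hle i
    omega

/-- Near `q`, `𝒱` lies in the projection of a compact set of pairs (base, sequence of value `1`) cut
out by closed lexicographic conditions, and these conditions characterize `𝒱` at `q`. -/
lemma mem_vNumbers_of_mem_closure {q : ℝ} (hq : 1 < q) (h : q ∈ closure vNumbers) :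
    q ∈ vNumbers := by
  obtain ⟨r, hr1, hrq⟩ := exists_between hq
  obtain ⟨M, hM⟩ := exists_nat_gt (q + 1)
  set K : Set (ℝ × (ℕ → ℕ)) := {p | p ∈ Icc r (q + 1) ×ˢ {a : ℕ → ℕ | ∀ i, a i ≤ M} ∧
    val p.1 p.2 ∈ ({1} : Set ℝ)} ∩ {p | (∀ k, shift k p.2 ≼ p.2) ∧
      ∀ k, 1 ≤ k → conj (p.2 0) (shift k p.2) ≼ p.2}
  have hK : IsCompact K := by
    have h1 : IsCompact (Icc r (q + 1) ×ˢ {a : ℕ → ℕ | ∀ i, a i ≤ M}) :=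
      isCompact_Icc.prod (isCompact_le M)
    refine (h1.of_isClosed_subset ?_ fun p hp => hp.1).inter_right ?_
    · exact ((continuousOn_val r hr1 M).mono fun p hp => ⟨hp.1.1, hp.2⟩).preimage_isClosed_of_isClosed
        h1.isClosed isClosed_singleton
    · have h2 : IsClosed {p : ℝ × (ℕ → ℕ) | ∀ k, shift k p.2 ≼ p.2} := by
        simp only [ofPred_forall]
        exact isClosed_iInter fun k => isClosed_sle.preimage
          (f := fun p : ℝ × (ℕ → ℕ) => (shift k p.2, p.2))
          (((continuous_shift k).comp continuous_snd).prodMk continuous_snd)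
      have h3 : IsClosed {p : ℝ × (ℕ → ℕ) | ∀ k, 1 ≤ k → conj (p.2 0) (shift k p.2) ≼ p.2} := by
        simp only [ofPred_forall]
        exact isClosed_iInter fun k => isClosed_iInter fun _ => isClosed_sle.preimage
          (f := fun p : ℝ × (ℕ → ℕ) => (conj (p.2 0) (shift k p.2), p.2))
          (((continuous_conj_apply_zero k).comp continuous_snd).prodMk continuous_snd)
      exact h2.inter h3
  have hsub : Icc r (q + 1) ∩ vNumbers ⊆ Prod.fst '' K := by
    rintro p ⟨hp, hpV⟩
    have hp1 := hpV.1
    refine ⟨(p, qg p), ⟨⟨⟨hp, fun i => ?_⟩, val_qg hp1⟩, shift_qg_le hp1,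
      (mem_vNumbers_iff hp1).1 hpV⟩, rfl⟩
    have : (qg p i : ℝ) < M := (qg_lt hp1 i).trans_le (hp.2.trans hM.le)
    exact_mod_cast this.le
  have hcl : q ∈ closure (Icc r (q + 1) ∩ vNumbers) := by
    rw [mem_closure_iff_frequently] at h ⊢
    have hI : ∀ᶠ x in 𝓝 q, x ∈ Icc r (q + 1) := Icc_mem_nhds hrq (by linarith)
    exact hI.and_frequently h
  have := (hK.image continuous_fst).isClosed.closure_subset_iff.2 hsub hcl
  obtain ⟨⟨p, a⟩, ⟨⟨⟨hp, ha⟩, hv⟩, hs, hc⟩, rfl⟩ := this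
  simp only at hs hc hq ha hv
  have h0 : a 0 ≠ 0 := by
    intro h0
    have : a = fun _ => 0 := funext fun i => by
      have := le_apply_zero_of_shift_le hs i
      omega
    rw [mem_singleton_iff, this, val_const hq] at hv
    simp at hv
  have e := eq_qg hq (isInfinite_of_conj_shift_le h0 hc (le_apply_zero_of_shift_le hs)) hs hv
  rw [mem_vNumbers_iff hq, ← e]
  exact hc

/-! ### Endpoints of the gaps -/

/-- A limit outside `wNumbers` would be the common endpoint of two gaps, hence isolated in `𝒱`. The
limit `1` is excluded by the gap starting there. -/
lemma closure_univoqueNumbers : closure univoqueNumbers = wNumbers := by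
  refine subset_antisymm (fun q hq => ?_) wNumbers_subset_closure
  have hUV : univoqueNumbers ⊆ vNumbers :=
    univoqueNumbers_subset_wNumbers.trans wNumbers_subset_vNumbers
  have hge : 1 ≤ q := by
    have : closure univoqueNumbers ⊆ Ici 1 := closure_minimal (fun p hp => hp.1.le) isClosed_Ici
    exact this hq
  have hex : ∀ s ∈ 𝓝 q, ∃ p ∈ s, p ∈ univoqueNumbers := fun s hs => by
    obtain ⟨p, h1, h2⟩ := mem_closure_iff_nhds.1 hq s hs
    exact ⟨p, h1, h2⟩
  rcases hge.eq_or_lt with rfl | hq1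
  · obtain ⟨q₂, h⟩ := exists_gapPair_of_nat le_rfl
    rw [Nat.cast_one] at h
    obtain ⟨p, hp, hpU⟩ := hex _ (Iio_mem_nhds h.one_lt)
    exact absurd (hUV hpU) ((isGap_iff.1 h.isGap).2.1 p ⟨hpU.1, hp⟩)
  · have hV := mem_vNumbers_of_mem_closure hq1 (closure_mono hUV hq)
    by_contra hW
    have hU : q ∉ univoqueNumbers := fun h => hW (univoqueNumbers_subset_wNumbers h)
    obtain ⟨_, _, q₂, hr⟩ := exists_gapPair_of_mem_diff hV hU
    obtain ⟨_, _, q₁, hl⟩ := exists_gapPair_right hV hW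
    obtain ⟨p, hp, hpU⟩ := hex _ (Ioo_mem_nhds hl.lt hr.lt)
    rcases lt_trichotomy p q with h | rfl | h
    · exact (isGap_iff.1 hl.isGap).2.1 p ⟨hp.1, h⟩ (hUV hpU)
    · exact hU hpU
    · exact (isGap_iff.1 hr.isGap).2.1 p ⟨h, hp.2⟩ (hUV hpU)

lemma mem_leftEndpoints_of_nat {n : ℕ} (hn : 1 ≤ n) : (n : ℝ) ∈ leftEndpoints := by
  obtain ⟨q₂, h⟩ := exists_gapPair_of_nat hn
  exact ⟨q₂, h.isGap⟩

lemma leftEndpoints_eq :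
    leftEndpoints = integersFrom 1 ∪ (vNumbers \ univoqueNumbers) := by
  refine subset_antisymm ?_ (union_subset ?_ ?_)
  · rintro q₁ ⟨q₂, h⟩
    rw [isGap_iff] at h
    rcases h.2.2.1 with rfl | hV
    · exact Or.inl ⟨1, le_rfl, by simp⟩
    · by_cases hU : q₁ ∈ univoqueNumbers
      · by_cases hN : q₁ ∈ integersFrom 2
        · obtain ⟨n, hn, rfl⟩ := hN
          exact Or.inl ⟨n, by omega, rfl⟩
        · obtain ⟨p, hp, hp'⟩ := exists_vNumbers_right hU hN h.1
          exact absurd hp (h.2.1 p hp')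
      · exact Or.inr ⟨hV, hU⟩
  · rintro _ ⟨n, hn, rfl⟩
    exact mem_leftEndpoints_of_nat hn
  · rintro q ⟨hV, hU⟩
    obtain ⟨_, _, q₂, h⟩ := exists_gapPair_of_mem_diff hV hU
    exact ⟨q₂, h.isGap⟩

lemma rightEndpoints_eq : rightEndpoints = vNumbers \ wNumbers := by
  refine subset_antisymm ?_ ?_
  · rintro q₂ ⟨q₁, h⟩
    rw [isGap_iff] at h
    refine ⟨h.2.2.2, fun hW => ?_⟩
    obtain ⟨p, hp, hp'⟩ := exists_vNumbers_left hW h.1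
    exact h.2.1 p hp' hp
  · rintro q ⟨hV, hW⟩
    obtain ⟨_, _, q₁, h⟩ := exists_gapPair_right hV hW
    exact ⟨q₁, h.isGap⟩

lemma exists_isGap_of_not_mem {q : ℝ} (hq : 1 < q) (hV : q ∉ vNumbers) :
    ∃ q₁ q₂, IsGap q₁ q₂ ∧ q ∈ Ioo q₁ q₂ := by
  -- Inserting `1` covers the case in which `𝒱` has no element below `q`.
  set A : Set ℝ := insert 1 (vNumbers ∩ Iic q)
  set B : Set ℝ := vNumbers ∩ Ici q
  have hAne : A.Nonempty := ⟨1, mem_insert _ _⟩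
  have hAbdd : BddAbove A := ⟨q, by rintro x (rfl | hx); exacts [hq.le, hx.2]⟩
  have hBne : B.Nonempty := by
    obtain ⟨n, hn⟩ := exists_nat_gt q
    refine ⟨n, integersFrom_subset_vNumbers ⟨n, ?_, rfl⟩, hn.le⟩
    have : (1 : ℝ) < n := hq.trans hn
    exact_mod_cast this
  have hBbdd : BddBelow B := ⟨q, fun x hx => hx.2⟩
  have h1A : 1 ≤ sSup A := le_csSup hAbdd (mem_insert _ _)
  have hAq : sSup A ≤ q := csSup_le hAne (by rintro x (rfl | hx); exacts [hq.le, hx.2])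
  have hBq : q ≤ sInf B := le_csInf hBne fun x hx => hx.2
  have hA : sSup A = 1 ∨ sSup A ∈ vNumbers := by
    have h := csSup_mem_closure hAne hAbdd
    change sSup A ∈ closure (insert 1 (vNumbers ∩ Iic q)) at h
    rw [insert_eq, closure_union, closure_singleton] at h
    rcases h with h | h
    · exact Or.inl h
    · rcases h1A.eq_or_lt with h' | h'
      · exact Or.inl h'.symm
      · exact Or.inr (mem_vNumbers_of_mem_closure h' (closure_mono inter_subset_left h))
  have hB : sInf B ∈ vNumbers := mem_vNumbers_of_mem_closure (hq.trans_le hBq)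
    (closure_mono inter_subset_left (csInf_mem_closure hBne hBbdd))
  have hAlt : sSup A < q := hAq.lt_of_ne fun e => by
    rcases hA with h | h
    · linarith
    · exact hV (e ▸ h)
  have hBlt : q < sInf B := hBq.lt_of_ne fun e => hV (e ▸ hB)
  refine ⟨sSup A, sInf B, isGap_iff.2 ⟨hAlt.trans hBlt, fun x hx hxV => ?_, hA, hB⟩, hAlt, hBlt⟩
  rcases le_total x q with h | h
  · exact (not_le.2 hx.1) (le_csSup hAbdd (Or.inr ⟨hxV, h⟩))
  · exact (not_le.2 hx.2) (csInf_le hBbdd ⟨hxV, h⟩)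

lemma compl_wNumbers_eq :
    Ioi (1 : ℝ) \ wNumbers = ⋃ (q₁ : ℝ) (q₂ : ℝ) (_ : IsGap q₁ q₂), Ioc q₁ q₂ := by
  ext q
  simp only [mem_iUnion, exists_prop]
  constructor
  · rintro ⟨hq, hW⟩
    by_cases hV : q ∈ vNumbers
    · obtain ⟨q₁, h⟩ := rightEndpoints_eq.symm.subset ⟨hV, hW⟩
      exact ⟨q₁, q, h, (isGap_iff.1 h).1, le_rfl⟩
    · obtain ⟨q₁, q₂, h, h'⟩ := exists_isGap_of_not_mem hq hV
      exact ⟨q₁, q₂, h, h'.1, h'.2.le⟩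
  · rintro ⟨q₁, q₂, h, hq⟩
    have h' := isGap_iff.1 h
    have h1 : 1 ≤ q₁ := h'.2.2.1.elim (fun h => h.ge) fun h => h.1.le
    refine ⟨h1.trans_lt hq.1, fun hW => ?_⟩
    rcases hq.2.eq_or_lt with rfl | hlt
    · exact (rightEndpoints_eq.subset ⟨q₁, h⟩).2 hW
    · exact h'.2.1 q ⟨hq.1, hlt⟩ (wNumbers_subset_vNumbers hW)

/-! ### Integer bases -/

/-- Here `qg` is the constant `M`, so admissibility can fail only at a tail of value `0` or `1`,
which would make `x` rational. -/
lemma irrational_mem_univoqueSet {M : ℕ} (hM : 1 ≤ M) {x : ℝ} (hx : Irrational x) (h0 : 0 ≤ x)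
    (h1 : x ≤ 1) : x ∈ univoqueSet (M + 1 : ℕ) := by
  set q : ℝ := ((M + 1 : ℕ) : ℝ) with hqdef
  have hq : 1 < q := by rw [hqdef]; exact_mod_cast Nat.lt_succ_of_le hM
  have hMq : (M : ℝ) / (q - 1) = 1 := by
    rw [hqdef]
    push_cast
    rw [add_sub_cancel_right, div_self]
    have : M ≠ 0 := by omega
    exact_mod_cast this
  have e0 : qg q 0 = M := by rw [hqdef, qg_natCast hM]
  obtain ⟨c, hc, hv⟩ := exists_expansion hq (M := M) (by rw [hqdef]; push_cast; rfl) h0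
    (by rw [hMq]; exact h1)
  have key : ∀ n (t : ℚ), val q (shift n c) ≠ t := by
    intro n t ht
    refine hx ⟨∑ i ∈ Finset.range n, (c i : ℚ) / (M + 1 : ℕ) ^ (i + 1) + t / (M + 1 : ℕ) ^ n, ?_⟩
    rw [← hv, val_split hq hc n, ht]
    push_cast
    simp [hqdef]
  have hlt : ∀ (n : ℕ) (a : ℕ → ℕ), (∀ i, a i ≤ M) → val q a ≠ 1 → a ≺ qg q := by
    intro n a ha hne
    have hqg : qg q = fun _ => M := by rw [hqdef, qg_natCast hM]
    have : a ≼ qg q := by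
      rw [← not_slt, slt_iff]
      rintro ⟨i, -, hi⟩
      rw [hqg] at hi
      exact absurd (ha i) (not_le.2 hi)
    refine this.lt_of_ne fun e => hne ?_
    rw [e, val_qg hq]
  refine (mem_univoqueSet_iff hq).2 ⟨c, ⟨e0.symm ▸ hc, fun n _ => ?_, fun n _ => ?_⟩, hv⟩
  · refine hlt n _ (fun i => hc _) fun h => key (n + 1) 1 ?_
    rw [h]; simp
  · rw [e0]
    refine hlt n _ (conj_le _ _) fun h => key (n + 1) 0 ?_
    rw [val_conj hq (c := shift (n + 1) c) (fun i => hc _), hMq] at h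
    push_cast
    linarith

lemma interior_closure_univoqueSet_nat {M : ℕ} (hM : 1 ≤ M) :
    (interior (closure (univoqueSet (M + 1 : ℕ)))).Nonempty := by
  refine ⟨1 / 2, mem_interior.2 ⟨Ioo 0 1, ?_, isOpen_Ioo, by norm_num, by norm_num⟩⟩
  refine (dense_irrational.open_subset_closure_inter isOpen_Ioo).trans (closure_mono ?_)
  rintro x ⟨hx, hirr⟩
  exact irrational_mem_univoqueSet hM hirr hx.1.le hx.2.le

lemma not_isCantorSet_nat {q : ℝ} (hq : q ∈ integersFrom 2) :
    ¬ IsCantorSet (univoqueSet q) ∧ ¬ IsCantorSet (closure (univoqueSet q)) := by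
  obtain ⟨n, hn, rfl⟩ := hq
  obtain ⟨M, rfl⟩ := Nat.exists_eq_add_of_le' (show 1 ≤ n by omega)
  have h := interior_closure_univoqueSet_nat (M := M) (by omega)
  constructor
  · rintro ⟨-, hcl, hint, -⟩
    rw [hcl.closure_eq, hint] at h
    exact not_nonempty_empty h
  · rintro ⟨-, -, hint, -⟩
    rw [hint] at h
    exact not_nonempty_empty h

/-! ### Topology of the univoque set -/

lemma univoqueSet_eq {q : ℝ} (hq : 1 < q) :
    univoqueSet q = val q '' admissible (qg q 0) (qg q) :=
  Set.ext fun _ => mem_univoqueSet_iff hq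

lemma exists_tie_val_lt {q : ℝ} (hq : 1 < q) (M : ℕ) {ε : ℝ} (hε : 0 < ε) :
    ∃ J, ∀ c d : ℕ → ℕ, (∀ i, c i ≤ M) → (∀ i, d i ≤ M) → Tie J c d → |val q c - val q d| < ε := by
  have hq0 : 0 < q := by linarith
  have h : Tendsto (fun n : ℕ => (M / (q - 1)) / q ^ n) atTop (𝓝 0) :=
    tendsto_const_nhds.div_atTop (tendsto_pow_atTop_atTop_of_one_lt hq)
  obtain ⟨J, hJ⟩ := (h.eventually (gt_mem_nhds hε)).exists
  refine ⟨J, fun c d hc hd ht => ?_⟩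
  have h1 := val_nonneg hq (shift J c)
  have h2 := val_nonneg hq (shift J d)
  have h3 := val_le hq (c := shift J c) fun i => hc _
  have h4 := val_le hq (c := shift J d) fun i => hd _
  rw [val_sub_of_tie hq hc hd ht, abs_div, abs_of_pos (pow_pos hq0 J)]
  refine lt_of_le_of_lt ?_ hJ
  have : |val q (shift J c) - val q (shift J d)| ≤ M / (q - 1) :=
    abs_le.2 ⟨by linarith, by linarith⟩
  gcongr

lemma accPt_univoqueSet {q : ℝ} (hq : 1 < q) {c : ℕ → ℕ} (hc : c ∈ admissible (qg q 0) (qg q))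
    (h : ∀ J, ∃ z ∈ admissible (qg q 0) (qg q), z ≠ c ∧ Tie J z c) :
    AccPt (val q c) (𝓟 (univoqueSet q)) := by
  rw [accPt_iff_nhds]
  intro s hs
  obtain ⟨ε, hε, hs⟩ := Metric.mem_nhds_iff.1 hs
  obtain ⟨J, hJ⟩ := exists_tie_val_lt hq (qg q 0) hε
  obtain ⟨z, hz, hne, ht⟩ := h J
  refine ⟨val q z, ⟨hs ?_, (mem_univoqueSet_iff hq).2 ⟨z, hz, rfl⟩⟩, fun e =>
    hne (eq_of_val_eq hq hc hz.1 e)⟩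
  rw [Metric.mem_ball, Real.dist_eq]
  exact hJ z c hz.1 hc.1 ht

lemma zero_mem_univoqueSet {q : ℝ} (hq : 1 < q) : (0 : ℝ) ∈ univoqueSet q := by
  refine (mem_univoqueSet_iff hq).2 ⟨fun _ => 0, ⟨fun _ => Nat.zero_le _, fun n _ => ?_, fun n hn =>
    absurd hn (lt_irrefl _)⟩, by rw [val_const hq]; simp⟩
  exact slt_of_apply_zero (qg_zero_pos hq)

/-- The closure of the univoque set in a non-integer base has no interior points. -/
lemma interior_closure_univoqueSet {q : ℝ} (hq : 1 < q) (hN : q ∉ integersFrom 2) :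
    interior (closure (univoqueSet q)) = ∅ := by
  have hq0 : 0 < q := by linarith
  set M := qg q 0 with hM
  have hM1 : 1 ≤ M := qg_zero_pos hq
  have hqM : q < M + 1 := (le_qg_zero hq).lt_of_ne fun e =>
    hN ⟨M + 1, by omega, by push_cast; exact e⟩
  have hgt : 1 < (M : ℝ) / (q - 1) := by rw [lt_div_iff₀ (by linarith)]; linarith
  rw [← not_nonempty_iff_eq_empty]
  rintro ⟨x, hx⟩
  obtain ⟨y, hyO, hyU⟩ := mem_closure_iff_nhds.1 (interior_subset hx) _
    (isOpen_interior.mem_nhds hx)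
  obtain ⟨c, hc, rfl⟩ := (mem_univoqueSet_iff hq).1 hyU
  obtain ⟨ε, hε, hball⟩ := Metric.mem_nhds_iff.1 (isOpen_interior.mem_nhds hyO)
  obtain ⟨J, hJ⟩ := exists_tie_val_lt hq M hε
  set A := ∑ i ∈ Finset.range J, (c i : ℝ) / q ^ (i + 1)
  -- After the first `J` digits of `c`, a rescaled remainder `t` in `(1, M / (q - 1))` allows the
  -- next digit to be `0` or `1`. Thus a whole interval near `val q c` has two expansions; it is
  -- nonempty because `q` is not an integer.
  have key : ∀ p ∈ Ioo (A + 1 / q ^ (J + 1)) (A + M / (q - 1) / q ^ (J + 1)),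
      p ∉ univoqueSet q ∧ |p - val q c| < ε := by
    rintro p ⟨hp1, hp2⟩
    set t := (p - A) * q ^ (J + 1) with ht
    have hpow : 0 < q ^ (J + 1) := by positivity
    have hp : p = A + t / q ^ (J + 1) := by rw [ht]; field_simp; ring
    have ht1 : 1 < t := by
      rw [ht, ← div_lt_iff₀ hpow]; linarith
    have ht2 : t < M / (q - 1) := by
      rw [ht, ← lt_div_iff₀ hpow]; linarith
    obtain ⟨e, he, hev⟩ := exists_expansion hq hqM.le (x := t) (by linarith) ht2.le
    obtain ⟨f, hf, hfv⟩ := exists_expansion hq hqM.le (x := t - 1) (by linarith) (by linarith)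
    have hval : ∀ (a : ℕ) (g : ℕ → ℕ), a ≤ M → (∀ i, g i ≤ M) →
        val q (append J c (append 1 (fun _ => a) g)) = A + (a + val q g) / q ^ (J + 1) := by
      intro a g ha hg
      have h1 := append_le (n := 1) (c := fun _ => a) (fun _ => ha) hg
      have hA : ∑ i ∈ Finset.range J, (append J c (append 1 (fun _ => a) g) i : ℝ) / q ^ (i + 1) =
          A := Finset.sum_congr rfl fun i hi => by rw [tie_append J c _ i (Finset.mem_range.1 hi)]
      rw [val_split hq (append_le (n := J) hc.1 h1) J, hA, shift_append, val_succ hq h1,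
        shift_append, div_div, pow_succ']
      rfl
    set d₀ := append J c (append 1 (fun _ => 0) e) with hd₀
    set d₁ := append J c (append 1 (fun _ => 1) f) with hd₁
    have hb₀ : ∀ i, d₀ i ≤ M := append_le hc.1 (append_le (fun _ => Nat.zero_le _) he)
    have hb₁ : ∀ i, d₁ i ≤ M := append_le hc.1 (append_le (fun _ => hM1) hf)
    have hv₀ : val q d₀ = p := by rw [hd₀, hval 0 e (Nat.zero_le _) he, hev, hp]; simp
    have hv₁ : val q d₁ = p := by rw [hd₁, hval 1 f hM1 hf, hfv, hp]; simp
    refine ⟨fun hpU => ?_, ?_⟩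
    · obtain ⟨z, hz, hzv⟩ := (mem_univoqueSet_iff hq).1 hpU
      have h0 := eq_of_val_eq hq hz hb₀ (hv₀.trans hzv.symm)
      have h1 := eq_of_val_eq hq hz hb₁ (hv₁.trans hzv.symm)
      have h2 := congrFun (h0.trans h1.symm) J
      simp [hd₀, hd₁, append] at h2
    · rw [← hv₀]
      exact hJ _ _ hb₀ hc.1 (tie_append _ _ _)
  obtain ⟨p, hp⟩ : (Ioo (A + 1 / q ^ (J + 1)) (A + M / (q - 1) / q ^ (J + 1))).Nonempty := by
    refine nonempty_Ioo.2 ?_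
    gcongr
  have hpcl : p ∈ closure (univoqueSet q) := by
    refine interior_subset (hball ?_)
    rw [Metric.mem_ball, Real.dist_eq]
    exact (key p hp).2
  obtain ⟨p', hp', hpU'⟩ := mem_closure_iff_nhds.1 hpcl _ (isOpen_Ioo.mem_nhds hp)
  exact (key p' hp').1 hpU'

/-! ### Gluing -/

lemma exists_forall_plt_of_slt {s : ℕ → ℕ} {t : ℕ → ℕ → ℕ} {P : ℕ → Prop}
    (h : ∀ l, P l → s ≺ t l) (N : ℕ) : ∃ n, ∀ l ≤ N, P l → PLt n s (t l) := by
  have h' : ∀ l, ∃ n, P l → PLt n s (t l) := fun l => by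
    by_cases hl : P l
    · obtain ⟨i, h1, h2⟩ := slt_iff.1 (h l hl)
      exact ⟨i + 1, fun _ => ⟨i, i.lt_succ_self, h1, h2⟩⟩
    · exact ⟨0, fun h => absurd h hl⟩
  choose f hf using h'
  exact ⟨(Finset.range (N + 1)).sup f, fun l hl hP => (hf l hP).mono
    (Finset.le_sup (f := f) (Finset.mem_range.2 (by omega)))⟩

/-- At suitable places, the tail of a sequence in `admissible M B` may be replaced by any
sequence `e` that is close to `a` and all of whose shifts are small. -/
lemma exists_append_mem_admissible {M : ℕ} {B B' a c : ℕ → ℕ} (hs : ∀ k, shift k B ≼ B)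
    (hBB' : B ≼ B') (ha : ∀ l, (1 ≤ l ∧ shift l B ≠ fun _ => 0) → conj M a ≺ shift l B)
    (hc : c ∈ admissible M B) (J : ℕ) :
    ∃ j ≥ J, ∃ n, ∀ e : ℕ → ℕ, (∀ i, e i ≤ M) →
      (∀ k, shift k e ≺ B' ∧ conj M (shift k e) ≺ B') → Tie n e a →
        append j c e ∈ admissible M B' := by
  -- At this cut all unreflected inequalities are already decided. Reflected ones may still tie
  -- there; then `conj M e` meets one of finitely many shifts of `B`, which closeness of `e` to `a`
  -- handles. A zero shift of `B` cannot occur after a tie.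
  obtain ⟨j, hj, hj'⟩ := exists_forall_plt (c := c) (P := fun k => ∃ n, k = n + 1 ∧ c n < M) hs
    (by rintro _ ⟨n, rfl, hn⟩; exact hc.2.1 n hn) J
  obtain ⟨n, hn⟩ := exists_forall_plt_of_slt ha j
  refine ⟨j, hj, n, fun e he hes ht => ⟨append_le hc.1 he, fun i hi => ?_, fun i hi => ?_⟩⟩
  · rcases Nat.lt_or_ge (i + 1) j with hij | hij
    · rw [shift_append_of_le hij.le]
      rw [tie_append j c e i (by omega)] at hi
      exact append_lt (Or.inl ((hj' (i + 1) hij ⟨i, rfl, hi⟩).trans_le (hBB'.ple _)))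
    · rw [shift_append_of_ge hij]
      exact (hes _).1
  · rcases Nat.lt_or_ge (i + 1) j with hij | hij
    · rw [shift_append_of_le hij.le, conj_append]
      rw [tie_append j c e i (by omega)] at hi
      refine SLt.trans_le (append_lt ?_) hBB'
      refine ((hc.2.2 i hi).cases (j - (i + 1))).imp id fun h => ⟨h.1, ?_⟩
      have h0 : shift (j - (i + 1)) B ≠ fun _ => 0 := fun h0 => by
        have := h.2
        rw [h0] at this
        obtain ⟨_, -, h3⟩ := slt_iff.1 this
        exact absurd h3 (Nat.not_lt_zero _)
      exact ((hn _ (by omega) ⟨by omega, h0⟩).congr (Tie.conj ht.symm) fun _ _ => rfl).lt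
    · rw [shift_append_of_ge hij]
      exact (hes _).2

lemma exists_ne_tie_mem_admissible {M : ℕ} {B a c : ℕ → ℕ} (hs : ∀ k, shift k B ≼ B)
    (ha : ∀ l, (1 ≤ l ∧ shift l B ≠ fun _ => 0) → conj M a ≺ shift l B)
    (he : ∀ n, ∃ e : ℕ → ℕ, (∀ i, e i ≤ M) ∧ (∀ k, shift k e ≺ B ∧ conj M (shift k e) ≺ B) ∧
      Tie n e a ∧ e ≠ a)
    (hc : c ∈ admissible M B) (J : ℕ) : ∃ z ∈ admissible M B, z ≠ c ∧ Tie J z c := by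
  obtain ⟨j, hj, n, h⟩ := exists_append_mem_admissible hs (SLe.refl B) ha hc J
  obtain ⟨e, he1, he2, he3, hne⟩ : ∃ e : ℕ → ℕ, (∀ i, e i ≤ M) ∧
      (∀ k, shift k e ≺ B ∧ conj M (shift k e) ≺ B) ∧ Tie n e a ∧ e ≠ shift j c := by
    -- If the tail of `c` is already `a`, an approximant different from `a` is needed; otherwise any
    -- one close enough to `a` differs from the tail.
    by_cases hca : shift j c = a
    · rw [hca]; exact he n
    · obtain ⟨i, hi⟩ := Function.ne_iff.1 hca
      obtain ⟨e, he1, he2, he3, -⟩ := he (max n (i + 1))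
      exact ⟨e, he1, he2, he3.mono (le_max_left _ _), fun h => hi
        (by rw [← h, he3 i (lt_max_of_lt_right i.lt_succ_self)])⟩
  refine ⟨_, h e he1 he2 he3, fun e' => hne ?_, (tie_append j c e).mono hj⟩
  rw [← e', shift_append]

/-! ### Bases in the closure of `𝒰` -/

lemma accPt_of_mem_wNumbers {q : ℝ} (hq : q ∈ wNumbers) {x : ℝ} (hx : x ∈ univoqueSet q) :
    AccPt x (𝓟 (univoqueSet q)) := by
  have hq1 := hq.1
  obtain ⟨c, hc, rfl⟩ := (mem_univoqueSet_iff hq1).1 hx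
  refine accPt_univoqueSet hq1 hc fun J => exists_ne_tie_mem_admissible (a := qg q)
    (shift_qg_le hq1) (fun l hl => ?_) (fun n => ?_) hc J
  · have h := (hq.2 l hl.1).conj (qg_le hq1)
    rwa [conj_conj_shift (qg_le hq1)] at h
  · obtain ⟨e, he, -, ht, hlt, -, hes⟩ := exists_low_approx hq n
    exact ⟨e, he, fun k => ⟨(hes k).1.trans_lt hlt, (hes k).2.trans_lt hlt⟩, ht,
      fun h => SLt.irrefl _ (h ▸ hlt)⟩

/-- The missing limit point is `1 / q`, with the two expansions `0 (qg q)` and `1 0^∞`; it is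
approximated by `0 e`, with `e` from `exists_low_approx`. -/
lemma not_isClosed_univoqueSet {q : ℝ} (hq : q ∈ wNumbers) : ¬ IsClosed (univoqueSet q) := by
  intro hcl
  have hq1 := hq.1
  set d := append 1 (fun _ => 0) (qg q) with hd
  have hdle : ∀ i, d i ≤ qg q 0 := append_le (fun _ => Nat.zero_le _) (qg_le hq1)
  have hmem : val q d ∈ closure (univoqueSet q) := by
    refine Metric.mem_closure_iff.2 fun ε hε => ?_
    obtain ⟨J, hJ⟩ := exists_tie_val_lt hq1 (qg q 0) hε
    obtain ⟨e, he, -, ht, hlt, -, hes⟩ := exists_low_approx hq J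
    have hz : append 1 (fun _ => 0) e ∈ admissible (qg q 0) (qg q) := by
      refine ⟨append_le (fun _ => Nat.zero_le _) he, fun n _ => ?_, fun n _ => ?_⟩
      · rw [shift_append_of_ge (by omega)]
        exact (hes _).1.trans_lt hlt
      · rw [shift_append_of_ge (by omega)]
        exact (hes _).2.trans_lt hlt
    refine ⟨_, (mem_univoqueSet_iff hq1).2 ⟨_, hz, rfl⟩, hJ _ _ hdle hz.1 fun i hi => ?_⟩
    simp only [hd, append]
    split_ifs
    · rfl
    · exact (ht _ (by omega)).symm
  rw [hcl.closure_eq] at hmem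
  obtain ⟨c, hc, hv⟩ := (mem_univoqueSet_iff hq1).1 hmem
  set f := append 1 (fun _ => 1) (fun _ => 0) with hf
  have hfle : ∀ i, f i ≤ qg q 0 := append_le (fun _ => qg_zero_pos hq1) fun _ => Nat.zero_le _
  have hval : val q f = val q d := by
    rw [val_succ hq1 hfle, val_succ hq1 hdle, hf, hd, shift_append, shift_append, val_qg hq1,
      val_const hq1]
    simp [append]
  have h1 := eq_of_val_eq hq1 hc hdle hv.symm
  have h2 := eq_of_val_eq hq1 hc hfle (hval.trans hv.symm)
  have h3 := congrFun (h1.trans h2.symm) 0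
  simp [hd, hf, append] at h3

lemma isCantorSet_closure {q : ℝ} (hq : q ∈ wNumbers) (hN : q ∉ integersFrom 2) :
    IsCantorSet (closure (univoqueSet q)) := by
  refine ⟨⟨0, subset_closure (zero_mem_univoqueSet hq.1)⟩, isClosed_closure,
    interior_closure_univoqueSet hq.1 hN, eq_empty_of_forall_notMem ?_⟩
  rintro x ⟨hx, hacc⟩
  refine hacc (AccPt.mono ?_ (principal_mono.2 subset_closure))
  by_cases hxU : x ∈ univoqueSet q
  · exact accPt_of_mem_wNumbers hq hxU
  · rw [accPt_principal_iff_clusterPt, sdiff_singleton_eq_self hxU]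
    exact mem_closure_iff_clusterPt.1 hx

/-! ### Bases in a gap -/

lemma GapWord.shift_le {M m : ℕ} {u : ℕ → ℕ} (h : GapWord M m u) (k : ℕ) : shift k u ≼ u := by
  have hz : ∀ l, m ≤ l → shift l u ≼ shift (l - k) u := fun l hl =>
    not_slt.1 (h.not_slt_tail hl _)
  rcases Nat.eq_zero_or_pos k with rfl | hk
  · rw [shift_zero]; exact SLe.refl _
  · rcases lt_or_ge k m with hkm | hkm
    · rcases h.suffix_le k hk hkm with h1 | h1
      · exact h1.lt.le
      · refine h1.le ?_
        rw [shift_shift, Nat.add_sub_cancel' hkm.le]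
        exact hz m le_rfl
    · exact not_slt.1 (h.not_slt_tail hkm _)

lemma GapWord.conj_slt_shift {M m : ℕ} {u a : ℕ → ℕ} (h : GapWord M m u) (ht : Tie (m - 1) a u)
    (l : ℕ) (hl : 1 ≤ l ∧ shift l u ≠ fun _ => 0) : conj M a ≺ shift l u := by
  have hlm : l < m := by
    by_contra! hlm
    exact hl.2 (funext fun i => h.tail _ (by omega))
  have h1 := (h.conj_suffix_lt l hl.1 hlm).conj h.le
  rw [conj_conj_shift h.le] at h1
  exact (h1.congr (Tie.conj (ht.mono (by omega))).symm fun _ _ => rfl).lt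

/-- As `u` vanishes from `m` on, being below it is decided by the first `m` digits, so the strict
inequalities are closed conditions. -/
lemma isClosed_admissible {M m : ℕ} {u : ℕ → ℕ} (h : GapWord M m u) :
    IsClosed (admissible M u) := by
  have hlt : IsClosed {a : ℕ → ℕ | a ≺ u} := by
    have e : {a : ℕ → ℕ | a ≺ u} =
        ⋃ i ∈ Finset.range m, (⋂ j ∈ Finset.range i, {a | a j = u j}) ∩ {a | a i < u i} := by
      ext a
      simp only [mem_ofPred_eq, mem_iUnion, mem_inter_iff, mem_iInter, Finset.mem_range]
      constructor
      · intro ha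
        obtain ⟨i, hi, h1, h2⟩ := h.plt_of_slt ha
        exact ⟨i, hi, h1, h2⟩
      · rintro ⟨i, hi, h1, h2⟩
        exact slt_iff.2 ⟨i, h1, h2⟩
    rw [e]
    refine isClosed_biUnion_finset fun i _ => (isClosed_biInter fun j _ => ?_).inter ?_
    · exact (isClosed_discrete {x : ℕ | x = u j}).preimage (f := fun a : ℕ → ℕ => a j)
        (continuous_apply j)
    · exact (isClosed_discrete {x : ℕ | x < u i}).preimage (f := fun a : ℕ → ℕ => a i)
        (continuous_apply i)
  have hshift : ∀ n, Continuous fun c : ℕ → ℕ => shift (n + 1) c := fun n => continuous_shift _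
  have hconj : Continuous (conj M) := by
    refine continuous_pi fun i => ?_
    have h : Continuous fun x : ℕ => M - x := continuous_of_discreteTopology
    exact h.comp (continuous_apply i)
  have e : admissible M u = {c | ∀ i, c i ≤ M} ∩
      ((⋂ n, {c | c n < M}ᶜ ∪ shift (n + 1) ⁻¹' {a | a ≺ u}) ∩
      ⋂ n, {c | 0 < c n}ᶜ ∪ (fun c => conj M (shift (n + 1) c)) ⁻¹' {a | a ≺ u}) := by
    ext c
    simp only [admissible, mem_ofPred_eq, mem_inter_iff, mem_iInter, mem_union, mem_compl_iff,
      mem_preimage, imp_iff_not_or]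
  have hd : ∀ (s : Set ℕ) (n : ℕ), IsClosed {c : ℕ → ℕ | c n ∈ s}ᶜ := fun s n =>
    ((isOpen_discrete s).preimage (continuous_apply n)).isClosed_compl
  rw [e]
  refine (isCompact_le M).isClosed.inter (IsClosed.inter ?_ ?_)
  · exact isClosed_iInter fun n => (hd (Iio M) n).union (hlt.preimage (hshift n))
  · exact isClosed_iInter fun n => (hd (Ioi 0) n).union (hlt.preimage (hconj.comp (hshift n)))

lemma isCompact_admissible {M m : ℕ} {u : ℕ → ℕ} (h : GapWord M m u) :
    IsCompact (admissible M u) :=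
  (isCompact_le M).of_isClosed_subset (isClosed_admissible h) fun _ hc => hc.1

namespace GapPair

variable {M m : ℕ} {u : ℕ → ℕ} {q₁ q₂ q : ℝ}

lemma qg_zero (h : GapPair M m u q₁ q₂) (hq : q ∈ Ioc q₁ q₂) : qg q 0 = M := by
  have h1 := (h.slt_qg hq.1).le.apply_zero
  have h2 := (h.qg_sle hq).apply_zero
  rw [h.word.zero] at h1
  rw [h.word.highSeq_zero] at h2
  omega

/-- The admissible sequences do not depend on the base in a gap. -/
lemma admissible_eq (h : GapPair M m u q₁ q₂) (hq : q ∈ Ioc q₁ q₂) :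
    admissible (qg q 0) (qg q) = admissible M u := by
  rw [h.qg_zero hq]
  have hlt := h.slt_qg hq.1
  have hle := h.qg_sle hq
  -- A tail reaching `u` would start with the word, whose last digit is positive. The reflected
  -- inequality after that digit bounds the rest from below by `conj M (highSeq M m u)`, while the
  -- tail being below `highSeq M m u` bounds it strictly from above by the same sequence.
  have key : ∀ c ∈ admissible M (qg q), ∀ n, c n < M → shift (n + 1) c ≺ u := by
    intro c hc n hn
    by_contra hnot
    have hd := hc.2.1 n hn
    have ht : Tie m (shift (n + 1) c) (highSeq M m u) := by
      refine ((hd.trans_le hle).le.ple m).resolve_left fun h1 => ?_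
      exact SLt.irrefl _ ((not_slt.1 hnot).trans_lt
        (h1.congr (fun _ _ => rfl) GapWord.tie_highSeq).lt)
    have h1 := ht.shift_lt (hd.trans_le hle)
    rw [h.word.shift_highSeq] at h1
    have hdig : 0 < c (n + 1 + (m - 1)) := by
      have h2 := ht (m - 1) (by have := h.word.length_pos; omega)
      rw [shift_apply, GapWord.tie_highSeq _ (by have := h.word.length_pos; omega)] at h2
      rw [h2]
      exact h.word.last
    have h3 := (hc.2.2 _ hdig).trans_le hle
    have e : n + 1 + (m - 1) + 1 = n + 1 + m := by have := h.word.length_pos; omega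
    rw [e] at h3
    have h4 := h3.conj h.word.highSeq_le
    rw [conj_conj_shift hc.1] at h4
    rw [shift_shift] at h1
    exact SLt.irrefl _ (h1.trans h4)
  refine subset_antisymm (fun c hc => ⟨hc.1, key c hc, fun n hn => ?_⟩)
    fun c hc => ⟨hc.1, fun n hn => (hc.2.1 n hn).trans hlt, fun n hn => (hc.2.2 n hn).trans hlt⟩
  rw [conj_shift]
  refine key _ (conj_mem_admissible hc) n ?_
  have := hc.1 n
  simp only [conj_apply]
  omega

lemma isClosed_univoqueSet (h : GapPair M m u q₁ q₂) (hq : q ∈ Ioc q₁ q₂) :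
    IsClosed (univoqueSet q) := by
  have hq1 := h.one_le.trans_lt hq.1
  rw [univoqueSet_eq hq1, h.admissible_eq hq]
  exact ((isCompact_admissible h.word).image_of_continuousOn
    ((continuousOn_val_right hq1 M).mono fun _ hc => hc.1)).isClosed

/-- Gluing needs only the first `m - 1` digits of `a` to agree with `u`, so `a` may be `(u⁻)^∞`. -/
lemma isCantorSet (h : GapPair M m u q₁ q₂) (hq : q ∈ Ioc q₁ q₂) {a : ℕ → ℕ}
    (ha : Tie (m - 1) a u)
    (he : ∀ n, ∃ e : ℕ → ℕ, (∀ i, e i ≤ M) ∧ (∀ k, shift k e ≺ u ∧ conj M (shift k e) ≺ u) ∧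
      Tie n e a ∧ e ≠ a) (hN : q ∉ integersFrom 2) : IsCantorSet (univoqueSet q) := by
  have hq1 := h.one_le.trans_lt hq.1
  have hcl := h.isClosed_univoqueSet hq
  refine ⟨⟨0, zero_mem_univoqueSet hq1⟩, hcl, ?_, eq_empty_of_forall_notMem ?_⟩
  · have := interior_closure_univoqueSet hq1 hN
    rwa [hcl.closure_eq] at this
  · rintro x ⟨hx, hacc⟩
    obtain ⟨c, hc, rfl⟩ := (mem_univoqueSet_iff hq1).1 hx
    refine hacc (accPt_univoqueSet hq1 hc fun J => ?_)
    rw [h.admissible_eq hq] at hc ⊢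
    exact exists_ne_tie_mem_admissible h.word.shift_le (h.word.conj_slt_shift ha) he hc J

/-- If isolated admissible sequences approximate every admissible sequence, then the isolated
points of the univoque set are dense. -/
lemma subset_closure_isolatedPoints (h : GapPair M m u q₁ q₂) (hq : q ∈ Ioc q₁ q₂)
    (hd : ∀ c ∈ admissible M u, ∀ J, ∃ z ∈ admissible M u, Tie J z c ∧
      ∃ l, ∀ d ∈ admissible M u, Tie l d z → d = z) :
    univoqueSet q ⊆ closure (isolatedPoints (univoqueSet q)) := by
  have hq1 := h.one_le.trans_lt hq.1
  rintro x hx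
  obtain ⟨c, hc, rfl⟩ := (mem_univoqueSet_iff hq1).1 hx
  refine Metric.mem_closure_iff.2 fun ε hε => ?_
  obtain ⟨J, hJ⟩ := exists_tie_val_lt hq1 M hε
  rw [h.admissible_eq hq] at hc
  obtain ⟨z, hz, ht, l, hl⟩ := hd c hc J
  have hz' := hz
  rw [← h.admissible_eq hq] at hz'
  refine ⟨val q z, ⟨(mem_univoqueSet_iff hq1).2 ⟨z, hz', rfl⟩, ?_⟩, hJ _ _ hc.1 hz.1 ht.symm⟩
  have hopen : IsOpen {d : ℕ → ℕ | Tie l d z} := by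
    have e : {d : ℕ → ℕ | Tie l d z} = ⋂ i ∈ Finset.range l, {d | d i = z i} := by
      ext d
      simp [Tie]
    rw [e]
    exact isOpen_biInter_finset fun i _ =>
      (isOpen_discrete {x : ℕ | x = z i}).preimage (f := fun d : ℕ → ℕ => d i) (continuous_apply i)
  -- The remaining admissible sequences have a compact set of values, which misses `val q z` by
  -- uniqueness of its expansion.
  have hcomp : IsCompact (admissible M u \ {d | Tie l d z}) :=
    (isCompact_admissible h.word).diff hopen
  have hcl := (hcomp.image_of_continuousOn
    ((continuousOn_val_right hq1 M).mono fun _ hd => hd.1.1)).isClosed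
  rw [accPt_iff_nhds]
  push Not
  refine ⟨_, hcl.isOpen_compl.mem_nhds ?_, ?_⟩
  · rintro ⟨d, ⟨hdm, hd⟩, hv⟩
    have hdz : d = z := eq_of_val_eq hq1 hz' (by rw [h.qg_zero hq]; exact hdm.1) hv
    exact hd (hdz ▸ fun _ _ => rfl)
  · rintro y ⟨hy, hyU⟩
    obtain ⟨d, hd, rfl⟩ := (mem_univoqueSet_iff hq1).1 hyU
    rw [h.admissible_eq hq] at hd
    have : Tie l d z := by
      by_contra hn
      exact hy ⟨d, ⟨hd, hn⟩, rfl⟩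
    rw [hl d hd this]

end GapPair

/-- Admissible sequences for a word defining a gap do not exceed the periodic sequence of the left
endpoint. -/
lemma GapWord.shift_le_lowSeq {M m : ℕ} {u c : ℕ → ℕ} (h : GapWord M m u)
    (hc : c ∈ admissible M u) {n : ℕ} (hn : c n < M) : shift (n + 1) c ≼ lowSeq m u := by
  -- A tail that agrees with `lowSeq m u` over a whole period ends that period with a digit below `u
  -- (m - 1) ≤ M`, so the hypothesis on the preceding digit holds again for the next block.
  have key : ∀ i n, c n < M → Tie i (lowSeq m u) (shift (n + 1) c) →
      ¬ lowSeq m u i < shift (n + 1) c i := by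
    intro i
    induction i using Nat.strong_induction_on with
    | _ i ih =>
      intro n hn ht hlt
      have h1 := h.plt_of_slt (hc.2.1 n hn)
      have hm := h.length_pos
      rcases lt_or_ge i (m - 1) with him | him
      · refine SLt.irrefl _ (h1.lt.trans (slt_iff.2 ⟨i, ?_, ?_⟩))
        · exact (tie_lowSeq.symm.mono him.le).trans ht
        · rwa [lowSeq_apply_of_lt him] at hlt
      · have ht' : Tie (m - 1) u (shift (n + 1) c) := tie_lowSeq.symm.trans (ht.mono him)
        have h2 : shift (n + 1) c (m - 1) < u (m - 1) := by
          obtain ⟨j, hj, -, hj2⟩ := h1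
          rcases lt_or_ge j (m - 1) with hjm | hjm
          · exact absurd (ht' j hjm) hj2.ne'
          · obtain rfl : j = m - 1 := by omega
            exact hj2
        rcases him.eq_or_lt with rfl | him
        · rw [lowSeq_last hm] at hlt
          omega
        · have h3 := h.le (m - 1)
          have e : n + 1 + (m - 1) + 1 = n + 1 + m := by omega
          have hlow : ∀ j, lowSeq m u (m + j) = lowSeq m u j := fun j =>
            congrFun (shift_lowSeq m u) j
          refine ih (i - m) (by omega) (n + 1 + (m - 1)) (h2.trans_le h3) (fun j hj => ?_) ?_
          · rw [e, ← shift_shift, shift_apply, ← hlow]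
            exact ht (m + j) (by omega)
          · rw [e, ← shift_shift, shift_apply, ← hlow, show m + (i - m) = i by omega]
            exact hlt
  rw [← not_slt]
  intro hlt
  obtain ⟨i, h1, h2⟩ := slt_iff.1 hlt
  exact key i n hn h1 h2

/-- If the periodic sequence of the left endpoint of the gap of `u` is `(x conj x)^∞`, then the word
`x`, after a digit less than `M`, forces the remaining digits of an admissible sequence. -/
lemma GapWord.shift_eq_of_tie {M m k : ℕ} {u x c : ℕ → ℕ} (h : GapWord M m u) (hx : GapWord M k x)
    (e : lowSeq m u = highSeq M k x) (hc : c ∈ admissible M u) {n : ℕ} (hn : c n < M)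
    (ht : Tie k (shift (n + 1) c) x) : shift (n + 1) c = highSeq M k x := by
  have hk := hx.length_pos
  have h1 := h.shift_le_lowSeq hc hn
  rw [e] at h1
  have ht' : Tie k (shift (n + 1) c) (highSeq M k x) := ht.trans tie_highSeq.symm
  have h2 := ht'.shift_le h1
  have hdig : c (n + 1 + (k - 1)) = x (k - 1) := ht (k - 1) (by omega)
  have h3 : conj M c (n + 1 + (k - 1)) < M := by
    have := hx.last
    have := hx.le (k - 1)
    rw [conj_apply, hdig]
    omega
  -- Since `x` ends in a positive digit, the bound also applies to the reflected tail after `x`.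
  -- Together with `h2` it squeezes that tail to `conj M (highSeq M k x)`.
  have h4 := (h.shift_le_lowSeq (conj_mem_admissible hc) h3)
  rw [show n + 1 + (k - 1) + 1 = n + 1 + k by omega, e] at h4
  have h5 := h4.conj hx.highSeq_le
  rw [← conj_shift, conj_conj_shift hc.1] at h5
  refine ht'.eq ?_
  rw [hx.shift_highSeq] at h2 ⊢
  rw [shift_shift] at h2 ⊢
  exact h2.antisymm h5

lemma GapWord.isolated_of_tie {M m k : ℕ} {u x z : ℕ → ℕ} (h : GapWord M m u)
    (hx : GapWord M k x) (e : lowSeq m u = highSeq M k x) (hz : z ∈ admissible M u) {n : ℕ}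
    (hn : z n < M) (ht : Tie k (shift (n + 1) z) x) :
    ∃ l, ∀ d ∈ admissible M u, Tie l d z → d = z := by
  refine ⟨n + 1 + k, fun d hd hdz => (hdz.mono (by omega : n + 1 ≤ _)).eq ?_⟩
  rw [h.shift_eq_of_tie hx e hz hn ht]
  refine h.shift_eq_of_tie hx e hd (n := n) ?_ (Tie.trans (fun i hi => ?_) ht)
  · rwa [hdz n (by omega)]
  · exact hdz (n + 1 + i) (by omega)

/-- If `c` is admissible even for `x`, the tail `highSeq M k x` can be glued on far out and gives an
isolated neighbour. Otherwise `c` or its reflection already contains the forcing word, and `c` is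
itself isolated. -/
lemma GapWord.exists_isolated {M m k : ℕ} {u x : ℕ → ℕ} (h : GapWord M m u)
    (hx : GapWord M k x) (e : lowSeq m u = highSeq M k x) (hxu : x ≼ u)
    {c : ℕ → ℕ} (hc : c ∈ admissible M u) (J : ℕ) :
    ∃ z ∈ admissible M u, Tie J z c ∧ ∃ l, ∀ d ∈ admissible M u, Tie l d z → d = z := by
  have hk := hx.length_pos
  have hlow := h.plt_lowSeq.lt
  have hforced : ∀ c ∈ admissible M u, ∀ n, c n < M → ¬ shift (n + 1) c ≺ x →
      ∃ l, ∀ d ∈ admissible M u, Tie l d c → d = c := by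
    intro c hc n hn hnot
    refine h.isolated_of_tie hx e hc hn ?_
    have h1 := h.shift_le_lowSeq hc hn
    rw [e] at h1
    refine (((not_slt.1 hnot).ple k).resolve_left fun h2 => ?_).symm
    exact (h2.trans_le (h1.ple k)).not_tie tie_highSeq.symm
  by_cases hcx : c ∈ admissible M x
  · obtain ⟨j, hj, n, hjn⟩ := exists_append_mem_admissible hx.shift_le hxu
      (hx.conj_slt_shift (a := highSeq M k x) (tie_highSeq.mono (by omega))) hcx J
    have hz := hjn (highSeq M k x) hx.highSeq_le (fun i => by
      rw [e] at hlow
      exact ⟨(hx.shift_highSeq_le i).trans_lt hlow, (hx.conj_shift_highSeq_le i).trans_lt hlow⟩)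
      fun _ _ => rfl
    refine ⟨_, hz, (tie_append _ _ _).mono hj, ?_⟩
    -- Forcing is applied to the second period of the tail: the digit before it is the last one of
    -- `x̄`, which is below `M`, whereas the digit before the cut is not controlled.
    have e1 : j + (k + (k - 1)) + 1 = j + (k + k) := by omega
    refine h.isolated_of_tie hx e hz (n := j + (k + (k - 1))) ?_ ?_
    · have h1 : append j c (highSeq M k x) (j + (k + (k - 1))) = conj M (highSeq M k x) (k - 1) := by
        rw [← hx.shift_highSeq]
        exact congrFun (shift_append j c (highSeq M k x)) (k + (k - 1))
      have := hx.last
      have := hx.le (k - 1)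
      rw [h1, conj_apply, tie_highSeq _ (by omega)]
      omega
    · rw [e1, ← shift_shift, shift_append, hx.shift_highSeq_two]
      exact tie_highSeq
  · refine ⟨c, hc, fun _ _ => rfl, ?_⟩
    by_cases hn : ∃ n, c n < M ∧ ¬ shift (n + 1) c ≺ x
    · obtain ⟨n, hn, hnot⟩ := hn
      exact hforced c hc n hn hnot
    · push Not at hn
      have : ∃ n, 0 < c n ∧ ¬ conj M (shift (n + 1) c) ≺ x := by
        by_contra! h'
        exact hcx ⟨hc.1, hn, h'⟩
      obtain ⟨n, hn', hnot⟩ := this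
      have hcn := hc.1 n
      obtain ⟨l, hl⟩ := hforced (conj M c) (conj_mem_admissible hc) n
        (by simp only [conj_apply]; omega) (by rwa [← conj_shift])
      refine ⟨l, fun d hd hdc => ?_⟩
      rw [← conj_conj hd.1, ← conj_conj hc.1,
        hl (conj M d) (conj_mem_admissible hd) (Tie.conj hdc)]

/-! ### Gaps starting at an integer -/

lemma slt_of_gapWord_one {M : ℕ} {u a : ℕ → ℕ} (h : GapWord M 1 u) : a ≺ u ↔ a 0 < M := by
  constructor
  · intro ha
    obtain ⟨i, hi, -, h1⟩ := h.plt_of_slt ha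
    obtain rfl : i = 0 := by omega
    rwa [h.zero] at h1
  · intro ha
    exact slt_of_apply_zero (by rwa [h.zero])

/-- Here digits below `M` stay below `M` and positive digits stay positive. For `M = 1` admissible
sequences are constant; for `M = 2` the digit `1` is absorbing, so sequences reaching it are
isolated, and `1^∞` can be glued on. -/
lemma exists_isolated_of_le_two {M : ℕ} {u : ℕ → ℕ} (h : GapWord M 1 u) (hM : M ≤ 2)
    {c : ℕ → ℕ} (hc : c ∈ admissible M u) (J : ℕ) :
    ∃ z ∈ admissible M u, Tie J z c ∧ ∃ l, ∀ d ∈ admissible M u, Tie l d z → d = z := by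
  have hM1 := h.one_le
  have hup : ∀ d ∈ admissible M u, ∀ n, d n < M → d (n + 1) < M := fun d hd n hn => by
    simpa using (slt_of_gapWord_one h).1 (hd.2.1 n hn)
  have hdown : ∀ d ∈ admissible M u, ∀ n, 0 < d n → 0 < d (n + 1) := fun d hd n hn => by
    have := (slt_of_gapWord_one h).1 (hd.2.2 n hn)
    simp only [conj_apply, shift_apply, add_zero] at this
    omega
  rcases (show M = 1 ∨ M = 2 by omega) with rfl | rfl
  · refine ⟨c, hc, fun _ _ => rfl, 1, fun d hd hdc => funext fun i => ?_⟩
    induction i with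
    | zero => exact hdc 0 one_pos
    | succ i ih =>
      have := hup c hc i
      have := hup d hd i
      have := hdown c hc i
      have := hdown d hd i
      have := hc.1 i
      have := hc.1 (i + 1)
      have := hd.1 (i + 1)
      omega
  · have hone : ∀ d ∈ admissible 2 u, ∀ n, d n = 1 → ∀ i, d (n + i) = 1 := by
      intro d hd n hn i
      induction i with
      | zero => exact hn
      | succ i ih =>
        have := hup d hd (n + i) (by omega)
        have := hdown d hd (n + i) (by omega)
        rw [← add_assoc]
        omega
    have hiso : ∀ d ∈ admissible 2 u, ∀ n, d n = 1 →
        ∃ l, ∀ d' ∈ admissible 2 u, Tie l d' d → d' = d := by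
      intro d hd n hn
      refine ⟨n + 1, fun d' hd' ht => Tie.eq (ht.mono n.le_succ) (funext fun i => ?_)⟩
      rw [shift_apply, shift_apply, hone d hd n hn, hone d' hd' n (by rw [ht n (by omega), hn])]
    obtain ⟨j, hj, n, hjn⟩ := exists_append_mem_admissible h.shift_le (SLe.refl u)
      (h.conj_slt_shift (a := fun _ => 1) fun i hi => by omega) hc J
    have hz := hjn (fun _ => 1) (fun _ => by omega) (fun k => by
      rw [slt_of_gapWord_one h, slt_of_gapWord_one h]
      simp) fun _ _ => rfl
    refine ⟨_, hz, (tie_append _ _ _).mono hj, hiso _ hz j ?_⟩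
    simp [append]

/-! ### Univoque sets in the gaps -/

lemma IsGap.not_mem_integersFrom {q₁ q₂ q : ℝ} (h : IsGap q₁ q₂) (hq : q ∈ Ioc q₁ q₂) :
    q ∉ integersFrom 2 := by
  intro hN
  have h1 : q ∈ Ioi (1 : ℝ) \ wNumbers := by
    rw [compl_wNumbers_eq]
    simp only [mem_iUnion, exists_prop]
    exact ⟨q₁, q₂, h, hq⟩
  exact h1.2 (univoqueNumbers_subset_wNumbers (integersFrom_subset_univoqueNumbers hN))

lemma IsGap.exists_gapPair {q₁ q₂ : ℝ} (h : IsGap q₁ q₂) : ∃ M m u, GapPair M m u q₁ q₂ := by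
  have hL : q₁ ∈ leftEndpoints := ⟨q₂, h⟩
  rw [leftEndpoints_eq] at hL
  rcases hL with ⟨n, hn, rfl⟩ | ⟨hV, hU⟩
  · obtain ⟨q₂', h'⟩ := exists_gapPair_of_nat hn
    rw [h.right_unique h'.isGap]
    exact ⟨_, _, _, h'⟩
  · obtain ⟨m, u, q₂', h'⟩ := exists_gapPair_of_mem_diff hV hU
    rw [h.right_unique h'.isGap]
    exact ⟨_, _, _, h'⟩

/-- Every sequence in the digits `1, …, n - 1` is an allowed tail, and for `n ≥ 3` the digits `1`
and `n - 1` differ, so `(n - 1)^∞` is approximated by other such tails. -/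
lemma isCantorSet_of_integer {n : ℕ} (hn : 3 ≤ n) {q₂ q : ℝ} (h : IsGap n q₂)
    (hq : q ∈ Ioc (n : ℝ) q₂) : IsCantorSet (univoqueSet q) := by
  obtain ⟨q₂', h'⟩ := exists_gapPair_of_nat (M := n) (by omega)
  have hN := h.not_mem_integersFrom hq
  rw [h.right_unique h'.isGap] at hq
  refine h'.isCantorSet hq (a := fun _ => n - 1) (fun i hi => by omega) (fun N => ?_) hN
  refine ⟨append N (fun _ => n - 1) fun _ => 1, append_le (fun _ => by omega) fun _ => by omega,
    fun k => ?_, tie_append _ _ _, fun e => ?_⟩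
  · rw [slt_of_gapWord_one h'.word, slt_of_gapWord_one h'.word]
    simp only [conj_apply, shift_apply, add_zero, append]
    split_ifs <;> omega
  · have := congrFun e N
    simp only [append, lt_irrefl, if_false] at this
    omega

lemma isCantorSet_of_mem_wNumbers {q₁ q₂ q : ℝ} (hW : q₁ ∈ wNumbers) (hU : q₁ ∉ univoqueNumbers)
    (h : IsGap q₁ q₂) (hq : q ∈ Ioc q₁ q₂) : IsCantorSet (univoqueSet q) := by
  obtain ⟨m, u, q₂', h'⟩ := exists_gapPair_of_mem_diff (wNumbers_subset_vNumbers hW) hU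
  have hN := h.not_mem_integersFrom hq
  rw [h.right_unique h'.isGap] at hq
  have hlow : qg q₁ = lowSeq m u := h'.left.elim (fun h1 => absurd h1.1 hW.1.ne') And.right
  have hlt : qg q₁ ≺ u := hlow ▸ h'.word.plt_lowSeq.lt
  refine h'.isCantorSet hq (a := qg q₁) (hlow ▸ GapWord.tie_lowSeq) (fun n => ?_) hN
  obtain ⟨e, he, -, ht, hlt', -, hes⟩ := exists_low_approx hW n
  exact ⟨e, he, fun k => ⟨((hes k).1.trans_lt hlt').trans hlt, ((hes k).2.trans_lt hlt').trans hlt⟩,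
    ht, fun e' => SLt.irrefl _ (e' ▸ hlt')⟩

lemma dense_isolatedPoints_of_integer {n : ℕ} (hn1 : 1 ≤ n) (hn : n ≤ 2) {q₂ q : ℝ}
    (h : IsGap n q₂) (hq : q ∈ Ioc (n : ℝ) q₂) :
    univoqueSet q ⊆ closure (isolatedPoints (univoqueSet q)) := by
  obtain ⟨q₂', h'⟩ := exists_gapPair_of_nat hn1
  rw [h.right_unique h'.isGap] at hq
  exact h'.subset_closure_isolatedPoints hq fun c hc J => exists_isolated_of_le_two h'.word hn hc J

/-- Here `q₁` ends the gap of a word `x` and starts that of `u`, so `(u⁻)^∞ = (xx̄)^∞` and the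
forcing argument applies. -/
lemma dense_isolatedPoints_of_not_mem_wNumbers {q₁ q₂ q : ℝ} (hV : q₁ ∈ vNumbers)
    (hW : q₁ ∉ wNumbers) (h : IsGap q₁ q₂) (hq : q ∈ Ioc q₁ q₂) :
    univoqueSet q ⊆ closure (isolatedPoints (univoqueSet q)) := by
  obtain ⟨m, u, q₂', h'⟩ := exists_gapPair_of_mem_diff hV
    fun hU => hW (univoqueNumbers_subset_wNumbers hU)
  obtain ⟨k, x, q₀, h''⟩ := exists_gapPair_right hV hW
  rw [h.right_unique h'.isGap] at hq
  have hlow : qg q₁ = lowSeq m u := h'.left.elim (fun h1 => absurd h1.1 hV.1.ne') And.right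
  have hxu : x ≺ u := (h''.slt_qg h''.lt).trans (hlow ▸ h'.word.plt_lowSeq.lt)
  exact h'.subset_closure_isolatedPoints hq fun c hc J =>
    h'.word.exists_isolated h''.word (hlow.symm.trans h''.right) hxu.le hc J

lemma dense_isolatedPoints {q₁ q₂ q : ℝ} (h : IsGap q₁ q₂) (hq : q ∈ Ioc q₁ q₂)
    (hq₁ : q₁ ∈ ({1, 2} : Set ℝ) ∪ (vNumbers \ wNumbers)) :
    univoqueSet q ⊆ closure (isolatedPoints (univoqueSet q)) := by
  rcases hq₁ with (rfl | rfl) | ⟨hV, hW⟩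
  · exact dense_isolatedPoints_of_integer (n := 1) le_rfl (by omega) (by simpa using h)
      (by simpa using hq)
  · exact dense_isolatedPoints_of_integer (n := 2) (by omega) le_rfl (by simpa using h)
      (by simpa using hq)
  · exact dense_isolatedPoints_of_not_mem_wNumbers hV hW h hq

lemma isCantorSet_iff_of_isGap {q₁ q₂ q : ℝ} (h : IsGap q₁ q₂) (hq : q ∈ Ioc q₁ q₂) :
    IsCantorSet (univoqueSet q) ↔ q₁ ∈ integersFrom 3 ∪ (wNumbers \ univoqueNumbers) := by
  constructor
  · intro hC
    by_contra hn
    have hmem : q₁ ∈ ({1, 2} : Set ℝ) ∪ (vNumbers \ wNumbers) := by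
      have hL : q₁ ∈ leftEndpoints := ⟨q₂, h⟩
      rw [leftEndpoints_eq] at hL
      rcases hL with ⟨n, hn1, rfl⟩ | ⟨hV, hU⟩
      · have hn3 : n < 3 := by
          by_contra! hn3
          exact hn (Or.inl ⟨n, hn3, rfl⟩)
        refine Or.inl ?_
        rcases (show n = 1 ∨ n = 2 by omega) with rfl | rfl <;> simp
      · exact Or.inr ⟨hV, fun hW => hn (Or.inr ⟨hW, hU⟩)⟩
    have hd := dense_isolatedPoints h hq hmem
    rw [hC.2.2.2, closure_empty] at hd
    exact hC.1.ne_empty (subset_empty_iff.1 hd)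
  · rintro (⟨n, hn, rfl⟩ | ⟨hW, hU⟩)
    · exact isCantorSet_of_integer hn h hq
    · exact isCantorSet_of_mem_wNumbers hW hU h hq

end UniqueExpansions

open UniqueExpansions
theorem theorem1p6 :
    -- (i)
    (leftEndpoints = integersFrom 1 ∪ (vNumbers \ univoqueNumbers) ∧
      rightEndpoints = vNumbers \ closure univoqueNumbers ∧
      rightEndpoints ⊆ leftEndpoints ∧
      Ioi (1 : ℝ) \ closure univoqueNumbers =
        ⋃ (q₁ : ℝ) (q₂ : ℝ) (_ : IsGap q₁ q₂), Ioc q₁ q₂) ∧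
    -- (ii)
    (∀ q ∈ integersFrom 2,
      ¬ IsCantorSet (univoqueSet q) ∧ ¬ IsCantorSet (closure (univoqueSet q))) ∧
    -- (iii)
    (∀ q ∈ closure univoqueNumbers \ integersFrom 1,
      ¬ IsCantorSet (univoqueSet q) ∧ IsCantorSet (closure (univoqueSet q))) ∧
    -- (iv)
    (∀ q₁ q₂ : ℝ, IsGap q₁ q₂ → ∀ q ∈ Ioc q₁ q₂,
      IsClosed (univoqueSet q) ∧
      (IsCantorSet (univoqueSet q) ↔
        q₁ ∈ integersFrom 3 ∪ (closure univoqueNumbers \ univoqueNumbers)) ∧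
      (q₁ ∈ ({1, 2} : Set ℝ) ∪ (vNumbers \ closure univoqueNumbers) →
        univoqueSet q ⊆ closure (isolatedPoints (univoqueSet q)))) := by
  rw [closure_univoqueNumbers]
  refine ⟨⟨leftEndpoints_eq, rightEndpoints_eq, ?_, compl_wNumbers_eq⟩,
    fun q hq => not_isCantorSet_nat hq, ?_, ?_⟩
  · rw [leftEndpoints_eq, rightEndpoints_eq]
    exact fun q hq => Or.inr ⟨hq.1, fun hU => hq.2 (univoqueNumbers_subset_wNumbers hU)⟩
  · rintro q ⟨hW, hN⟩
    refine ⟨fun hC => not_isClosed_univoqueSet hW hC.2.1, isCantorSet_closure hW ?_⟩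
    rintro ⟨n, hn, rfl⟩
    exact hN ⟨n, by omega, rfl⟩
  · intro q₁ q₂ h q hq
    obtain ⟨M, m, u, h'⟩ := h.exists_gapPair
    exact ⟨h'.isClosed_univoqueSet hq, isCantorSet_iff_of_isGap h hq, dense_isolatedPoints h hq⟩
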